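/- Let $m,n\ge 1$. The Boolean rank of a binary matrix $B\in\{0,1\}^{m\times n}$ is the least $t$ such that $B$ is the component-wise disjunction of $t$ outer products $xy^{\mathsf T}$ with $x\in\{0,1\}^m$, $y\in\{0,1\}^n$. In the rank-1 Boolean matrix factorization problem we are given a matrix $A\in\mathbb Q^{m\times n}$ and the goal is to find $x\in\{0,1\}^m$ and $y\in\{0,1\}^n$ such that $B=xy^{\mathsf T}$ has Boolean rank $1$ and minimizes $\sum_{i=1}^m\sum_{j=1}^n (a_{ij}-b_{ij})^2$ among all binary $m\times n$ matrices of Boolean rank $1$. In the variant with the zero matrix allowed, "Boolean rank $1$" is replaced by "Boolean rank at most $1$" in both places. An algorithm runs in strongly polynomial time if, on every input $A\in\mathbb Q^{m\times n}$, it halts after a number of elementary steps that is at most a polynomial in $mn$ (elementary steps are additions, subtractions, multiplications, divisions and comparisons of rational numbers, memory accesses, and operations on indices and counters), and the encoding length of every number that occurs during the execution is at most a polynomial in the encoding length of $A$. For every fixed $r$, the rank-1 Boolean matrix factorization problem, restricted to input matrices $A$ of rank at most $r$, can be solved in strongly polynomial time (with a program and polynomials that may depend on $r$), where the input consists only of $m$,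 $n$ and $A$. The same holds for the variant with the zero matrix allowed. Moreover, for rational matrices $A\in\mathbb Q^{m\times n}$ of arbitrary rank, a rank factorization $A=CD^{\mathsf T}$ with $C\in\mathbb Q^{m\times k}$, $D\in\mathbb Q^{n\times k}$, $k=\operatorname{rank}A$, can be computed in strongly polynomial time. -/

import Mathlib

/-! ## The problem

Rank-one Boolean matrix factorization of a rational matrix, and rank factorizations. -/

namespace BooleanFactorization

/-- The disjunction of the `t` outer products of the binary vectors `u p` and `v p`. -/
def booleanProduct {m n t : ℕ} (u : Fin t → Fin m → Bool) (v : Fin t → Fin n → Bool) :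
    Matrix (Fin m) (Fin n) Bool :=
  Matrix.of fun i j => decide (∃ p : Fin t, u p i = true ∧ v p j = true)

/-- The Boolean rank: the least number of binary outer products whose disjunction is `B`. -/
noncomputable def booleanRank {m n : ℕ} (B : Matrix (Fin m) (Fin n) Bool) : ℕ :=
  sInf {t : ℕ | ∃ (u : Fin t → Fin m → Bool) (v : Fin t → Fin n → Bool), B = booleanProduct u v}

/-- Every binary matrix has a Boolean factorization, so the minimum in `booleanRank` is attained. -/
theorem exists_eq_booleanProduct {m n : ℕ} (B : Matrix (Fin m) (Fin n) Bool) :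
    ∃ (u : Fin (booleanRank B) → Fin m → Bool) (v : Fin (booleanRank B) → Fin n → Bool),
      B = booleanProduct u v := by
  have h : {t : ℕ | ∃ (u : Fin t → Fin m → Bool) (v : Fin t → Fin n → Bool),
      B = booleanProduct u v}.Nonempty := by
    refine ⟨m, fun p i => decide (p = i), fun p j => B p j, ?_⟩
    ext i j
    simp [booleanProduct]
  exact Nat.sInf_mem h

/-- The value of a truth value as a number, `0` or `1`. -/
def bit (b : Bool) : ℚ := if b = true then 1 else 0

/-- The sum of the squared differences of the entries of `A` and `B`. -/
def squaredError {m n : ℕ} (A : Matrix (Fin m) (Fin n) ℚ) (B : Matrix (Fin m) (Fin n) Bool) : ℚ :=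
  ∑ i, ∑ j, (A i j - bit (B i j)) ^ 2

/-- `B` belongs to `F` and no member of `F` is a better approximation of `A`. -/
def IsBestApproximation {m n : ℕ} (F : Set (Matrix (Fin m) (Fin n) Bool))
    (A : Matrix (Fin m) (Fin n) ℚ) (B : Matrix (Fin m) (Fin n) Bool) : Prop :=
  B ∈ F ∧ ∀ B' ∈ F, squaredError A B ≤ squaredError A B'

/-- `A = C Dᵀ`, where the number of columns of `C` and of `D` is the rank of `A`. -/
def IsRankFactorization {m n : ℕ} (A : Matrix (Fin m) (Fin n) ℚ)
    (C : Matrix (Fin m) (Fin A.rank) ℚ) (D : Matrix (Fin n) (Fin A.rank) ℚ) : Prop :=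
  A = C * D.transpose

end BooleanFactorization

/-! ## The machine model

Programs of a small imperative language that works on rational numbers.  A program has finitely
many arrays of rational numbers (with two indices) and finitely many arrays of natural numbers
(with one index; cell `0` of such an array serves as a counter).  Rational data can only be added,
subtracted, multiplied, divided and compared; the natural numbers serve as indices and counters,
and there is no conversion between the two kinds. -/

namespace RationalMachine

/-- A memory state: the arrays of natural numbers and the arrays of rational numbers.
The first argument is the name of the array. -/
structure State where
  nat : ℕ → ℕ → ℕ
  rat : ℕ → ℕ → ℕ → ℚ

/-- Write the value `k` into cell `i` of the natural number array `a`. -/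
def State.setNat (s : State) (a i k : ℕ) : State where
  nat := Function.update s.nat a (Function.update (s.nat a) i k)
  rat := s.rat

/-- Write the value `q` into cell `(i, j)` of the rational array `a`. -/
def State.setRat (s : State) (a i j : ℕ) (q : ℚ) : State where
  nat := s.nat
  rat := Function.update s.rat a
    (Function.update (s.rat a) i (Function.update (s.rat a i) j q))

/-- The encoding length of a rational number `p / q` in lowest terms:
one for the sign, plus the binary lengths of `|p|` and `q`. -/
def ratSize (q : ℚ) : ℕ := 1 + Nat.size q.num.natAbs + Nat.size q.den

/-- Natural number expressions; `sub` is truncated subtraction, `get a i` reads an array. -/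
inductive NatExpr where
  | const (k : ℕ)
  | get (a : ℕ) (i : NatExpr)
  | add (e f : NatExpr)
  | sub (e f : NatExpr)
  | mul (e f : NatExpr)

namespace NatExpr

def eval (s : State) : NatExpr → ℕ
  | const k => k
  | get a i => s.nat a (i.eval s)
  | add e f => e.eval s + f.eval s
  | sub e f => e.eval s - f.eval s
  | mul e f => e.eval s * f.eval s

/-- The number of elementary operations of an evaluation. -/
def cost : NatExpr → ℕ
  | const _ => 1
  | get _ i => i.cost + 1
  | add e f => e.cost + f.cost + 1
  | sub e f => e.cost + f.cost + 1
  | mul e f => e.cost + f.cost + 1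

/-- All numbers that occur in the evaluation have at most `L` bits. -/
def Fits (L : ℕ) (s : State) : NatExpr → Prop
  | const k => Nat.size k ≤ L
  | get a i => i.Fits L s ∧ Nat.size ((get a i).eval s) ≤ L
  | add e f => e.Fits L s ∧ f.Fits L s ∧ Nat.size ((add e f).eval s) ≤ L
  | sub e f => e.Fits L s ∧ f.Fits L s ∧ Nat.size ((sub e f).eval s) ≤ L
  | mul e f => e.Fits L s ∧ f.Fits L s ∧ Nat.size ((mul e f).eval s) ≤ L

end NatExpr

/-- Rational expressions; `get a i j` reads an array. -/
inductive RatExpr where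
  | const (q : ℚ)
  | get (a : ℕ) (i j : NatExpr)
  | add (e f : RatExpr)
  | sub (e f : RatExpr)
  | mul (e f : RatExpr)
  | div (e f : RatExpr)

namespace RatExpr

def eval (s : State) : RatExpr → ℚ
  | const q => q
  | get a i j => s.rat a (i.eval s) (j.eval s)
  | add e f => e.eval s + f.eval s
  | sub e f => e.eval s - f.eval s
  | mul e f => e.eval s * f.eval s
  | div e f => e.eval s / f.eval s

/-- The number of elementary operations of an evaluation. -/
def cost : RatExpr → ℕ
  | const _ => 1
  | get _ i j => i.cost + j.cost + 1
  | add e f => e.cost + f.cost + 1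
  | sub e f => e.cost + f.cost + 1
  | mul e f => e.cost + f.cost + 1
  | div e f => e.cost + f.cost + 1

/-- No division by zero occurs in the evaluation, and all numbers that occur in it have encoding
length at most `L`. -/
def Fits (L : ℕ) (s : State) : RatExpr → Prop
  | const q => ratSize q ≤ L
  | get a i j => i.Fits L s ∧ j.Fits L s ∧ ratSize ((get a i j).eval s) ≤ L
  | add e f => e.Fits L s ∧ f.Fits L s ∧ ratSize ((add e f).eval s) ≤ L
  | sub e f => e.Fits L s ∧ f.Fits L s ∧ ratSize ((sub e f).eval s) ≤ L
  | mul e f => e.Fits L s ∧ f.Fits L s ∧ ratSize ((mul e f).eval s) ≤ L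
  | div e f => e.Fits L s ∧ f.Fits L s ∧ f.eval s ≠ 0 ∧ ratSize ((div e f).eval s) ≤ L

end RatExpr

/-- Tests. -/
inductive Test where
  | natLe (e f : NatExpr)
  | ratLe (e f : RatExpr)
  | not (b : Test)
  | and (b c : Test)

namespace Test

def eval (s : State) : Test → Bool
  | natLe e f => decide (e.eval s ≤ f.eval s)
  | ratLe e f => decide (e.eval s ≤ f.eval s)
  | not b => !(b.eval s)
  | and b c => b.eval s && c.eval s

/-- The number of elementary operations of an evaluation. -/
def cost : Test → ℕ
  | natLe e f => e.cost + f.cost + 1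
  | ratLe e f => e.cost + f.cost + 1
  | not b => b.cost + 1
  | and b c => b.cost + c.cost + 1

/-- All numbers that occur in the evaluation have encoding length at most `L`. -/
def Fits (L : ℕ) (s : State) : Test → Prop
  | natLe e f => e.Fits L s ∧ f.Fits L s
  | ratLe e f => e.Fits L s ∧ f.Fits L s
  | not b => b.Fits L s
  | and b c => b.Fits L s ∧ c.Fits L s

end Test

/-- Programs: assignments to cells of arrays, sequences, conditionals and while loops. -/
inductive Program where
  | skip
  | setNat (a : ℕ) (i e : NatExpr)
  | setRat (a : ℕ) (i j : NatExpr) (e : RatExpr)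
  | seq (p q : Program)
  | ite (b : Test) (p q : Program)
  | loop (b : Test) (p : Program)

/-- `Runs L p s t s'`: started in state `s`, the program `p` halts in state `s'` after exactly `t`
elementary steps, and every number that occurs during the run has encoding length at most `L`.
Arithmetic operations on rational numbers, operations on indices, memory accesses, comparisons,
jumps and assignments are all counted.  The program `loop b p` repeats `p` while `b` is true. -/
inductive Runs (L : ℕ) : Program → State → ℕ → State → Prop
  | skip (s : State) : Runs L Program.skip s 1 s
  | setNat (a : ℕ) (i e : NatExpr) (s : State) (hi : i.Fits L s) (he : e.Fits L s) :
      Runs L (Program.setNat a i e) s (i.cost + e.cost + 1) (s.setNat a (i.eval s) (e.eval s))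
  | setRat (a : ℕ) (i j : NatExpr) (e : RatExpr) (s : State)
      (hi : i.Fits L s) (hj : j.Fits L s) (he : e.Fits L s) :
      Runs L (Program.setRat a i j e) s (i.cost + j.cost + e.cost + 1)
        (s.setRat a (i.eval s) (j.eval s) (e.eval s))
  | seq {p q : Program} {s s' s'' : State} {t t' : ℕ}
      (hp : Runs L p s t s') (hq : Runs L q s' t' s'') :
      Runs L (Program.seq p q) s (t + t') s''
  | ite_true {b : Test} {p : Program} (q : Program) {s s' : State} {t : ℕ}
      (hb : b.Fits L s) (h : b.eval s = true) (hp : Runs L p s t s') :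
      Runs L (Program.ite b p q) s (b.cost + 1 + t) s'
  | ite_false {b : Test} (p : Program) {q : Program} {s s' : State} {t : ℕ}
      (hb : b.Fits L s) (h : b.eval s = false) (hq : Runs L q s t s') :
      Runs L (Program.ite b p q) s (b.cost + 1 + t) s'
  | loop_true {b : Test} {p : Program} {s s' s'' : State} {t t' : ℕ}
      (hb : b.Fits L s) (h : b.eval s = true) (hp : Runs L p s t s')
      (hl : Runs L (Program.loop b p) s' t' s'') :
      Runs L (Program.loop b p) s (b.cost + 1 + t + t') s''
  | loop_false {b : Test} (p : Program) {s : State}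
      (hb : b.Fits L s) (h : b.eval s = false) :
      Runs L (Program.loop b p) s (b.cost + 1) s

/-- The initial state on input `A`: the format `m`, `n` is in cell `0` of the natural number arrays
`0` and `1`, the entries of `A` are in the rational array `0`, all other cells hold `0`. -/
def inputState {m n : ℕ} (A : Matrix (Fin m) (Fin n) ℚ) : State where
  nat := fun a i => if i = 0 then (if a = 0 then m else if a = 1 then n else 0) else 0
  rat := fun a i j => if h : a = 0 ∧ i < m ∧ j < n then A ⟨i, h.2.1⟩ ⟨j, h.2.2⟩ else 0

/-- The encoding length of the input. -/
def inputSize {m n : ℕ} (A : Matrix (Fin m) (Fin n) ℚ) : ℕ :=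
  Nat.size m + Nat.size n + ∑ i, ∑ j, ratSize (A i j)

/-- The matrix in the upper left `m × n` corner of the rational array `a`. -/
def State.matrix (s : State) (a m n : ℕ) : Matrix (Fin m) (Fin n) ℚ :=
  Matrix.of fun i j => s.rat a i j

/-- The problem of computing, for a nonempty rational matrix `A` with the property `Instance`, a
final state that is a `Solution` for `A` can be solved in strongly polynomial time: some program
solves it, with a number of elementary steps that is polynomial in the number of entries of `A`,
while the encoding length of all numbers that occur is polynomial in the encoding length of `A`. -/
def SolvableInStronglyPolynomialTime
    (Instance : (m n : ℕ) → Matrix (Fin m) (Fin n) ℚ → Prop)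
    (Solution : (m n : ℕ) → Matrix (Fin m) (Fin n) ℚ → State → Prop) : Prop :=
  ∃ (p : Program) (T S : Polynomial ℕ), ∀ (m n : ℕ) (A : Matrix (Fin m) (Fin n) ℚ),
    0 < m → 0 < n → Instance m n A →
      ∃ (t : ℕ) (s : State), Runs (S.eval (inputSize A)) p (inputState A) t s ∧
        t ≤ T.eval (m * n) ∧ Solution m n A s

end RationalMachine

namespace BooleanFactorization

/-- The first columns of the output arrays `1` and `2` are binary vectors `x`, `y` whose outer
product is a best approximation of `A` among the binary matrices with Boolean rank in `R`. -/
def OutputsBestApproximation (R : Set ℕ) (m n : ℕ) (A : Matrix (Fin m) (Fin n) ℚ)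
    (s : RationalMachine.State) : Prop :=
  ∃ (x : Fin m → Bool) (y : Fin n → Bool),
    (∀ i, s.matrix 1 m 1 i 0 = bit (x i)) ∧ (∀ j, s.matrix 2 n 1 j 0 = bit (y j)) ∧
      IsBestApproximation {B | booleanRank B ∈ R} A
        (booleanProduct (fun _ : Fin 1 => x) (fun _ : Fin 1 => y))

/-- Cell `0` of the natural number array `2` holds the rank `k` of `A`, and the first `k` columns of
the output arrays `1` and `2` form a rank factorization of `A`. -/
def OutputsRankFactorization (m n : ℕ) (A : Matrix (Fin m) (Fin n) ℚ)
    (s : RationalMachine.State) : Prop :=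
  s.nat 2 0 = A.rank ∧ IsRankFactorization A (s.matrix 1 m A.rank) (s.matrix 2 n A.rank)

end BooleanFactorization

/-! For a 0/1 number `b`, `(a - b)² = a² + (1 - 2a) b`, so the squared error of the outer product of
`x` and `y` is a constant plus the bilinear form `xᵀ W y` with `W = J - 2A`, `J` the all-ones matrix
(`squaredError_booleanProduct`). Since `J` has rank one, `W` has rank at most `d = r + 1`. For fixed
`y` the form is minimized by the indicator of the negative entries of `W y`, and for fixed `x` by
the negative column sums. Hence some optimal `x` is the negative support of a vector in the range
`U` of `W`, and it remains to list polynomially many vectors whose negative supports include such an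
`x`.

Fix `u₀ ∈ U`. The polyhedron of those `w ∈ U` with `w i ≤ -1` where `u₀ i < 0` and `w i ≥ 0`
elsewhere is nonempty, since `u₀` can be scaled up, and it contains no line. A point with the
largest number of tight constraints is a vertex: it is determined within `U` by its entries `0` and
`-1`, and it has the negative support of `u₀` (`exists_basic_negSupport_eq`). Such a vertex is found
without a basis of `U`: start with the zero vector, choose a pivot of the current matrix, add a
multiple of the pivot column so that the entry in the pivot row becomes `0` or `-1`, and eliminate.
Each elimination lowers the rank, so `d` levels suffice (`reachable_of_rank_le`). Trying all pivots
and both values is a recursion of fixed depth `d` with at most `2mn` branches per level;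
`halts_search` verifies the program. One level multiplies heights by at most five, and `5 ^ d` is a
constant.

A candidate replaces the incumbent only if its value is negative, which forces both vectors to be
nonzero. If zero is allowed, the search starts from the zero vectors. If Boolean rank one is
required, it starts from the least entry of `W`: when no pair has a negative value, all entries are
nonnegative and this single entry is optimal.

The rank factorization peels off one rank-one matrix per pivot. The number of pivots is now
unbounded, so a constant growth factor per step is useless. Instead every intermediate matrix is a
Schur complement in `A`, hence its entries are quotients of minors of `A`
(`IsSchurComplement.heightLe`), and minors have encoding length bounded by that of `A` up to a
constant factor (`heightLe_det_submatrix`). -/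

namespace RationalMachine

/-! ### Heights of rational numbers -/

/-- The denominator and the absolute value of the numerator of `q` are at most `2 ^ B`. -/
def HeightLe (B : ℕ) (q : ℚ) : Prop := q.den ≤ 2 ^ B ∧ q.num.natAbs ≤ 2 ^ B

namespace HeightLe

theorem mono {B C : ℕ} {q : ℚ} (h : HeightLe B q) (hBC : B ≤ C) : HeightLe C q :=
  ⟨h.1.trans (Nat.pow_le_pow_right two_pos hBC), h.2.trans (Nat.pow_le_pow_right two_pos hBC)⟩

/-- A number up to `2 ^ B` has at most `B + 1` bits; two of them and the sign give `2 * B + 3`. This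
is the source of the side conditions `2 * B + 3 ≤ L` throughout. -/
theorem ratSize_le {B : ℕ} {q : ℚ} (h : HeightLe B q) : ratSize q ≤ 2 * B + 3 := by
  have aux : ∀ x : ℕ, x ≤ 2 ^ B → Nat.size x ≤ B + 1 := fun x hx => by
    rw [Nat.size_le, pow_succ]
    have := Nat.pow_pos (n := B) two_pos
    omega
  have h1 := aux _ h.1
  have h2 := aux _ h.2
  unfold ratSize
  omega

theorem of_ratSize (q : ℚ) : HeightLe (ratSize q) q := by
  constructor
  · exact (Nat.lt_size_self q.den).le.trans
      (Nat.pow_le_pow_right two_pos (by unfold ratSize; omega))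
  · exact (Nat.lt_size_self q.num.natAbs).le.trans
      (Nat.pow_le_pow_right two_pos (by unfold ratSize; omega))

/-- Reducing a fraction only replaces numerator and denominator by divisors, so any representation
bounds the height. All arithmetic rules below use the obvious unreduced fraction. -/
theorem of_eq_div {B : ℕ} {q : ℚ} {a b : ℤ} (hb : b ≠ 0) (h : q = a / b)
    (ha' : a.natAbs ≤ 2 ^ B) (hb' : b.natAbs ≤ 2 ^ B) : HeightLe B q := by
  rcases eq_or_ne a 0 with rfl | ha
  · simp only [Int.cast_zero, zero_div] at h
    subst h
    exact ⟨Nat.one_le_two_pow, by simp⟩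
  · have h1 : (q.den : ℤ) ∣ b := by rw [h, ← Rat.divInt_eq_div]; exact Rat.den_dvd a b
    have h2 : q.num ∣ a := by rw [h, ← Rat.divInt_eq_div]; exact Rat.num_dvd a hb
    constructor
    · refine le_trans ?_ hb'
      simpa using Nat.le_of_dvd (Int.natAbs_pos.2 hb) (Int.natAbs_dvd_natAbs.2 h1)
    · exact (Nat.le_of_dvd (Int.natAbs_pos.2 ha) (Int.natAbs_dvd_natAbs.2 h2)).trans ha'

variable {B C : ℕ} {p q : ℚ}

theorem zero (B : ℕ) : HeightLe B 0 := ⟨Nat.one_le_two_pow, by simp⟩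

theorem one (B : ℕ) : HeightLe B 1 := ⟨Nat.one_le_two_pow, Nat.one_le_two_pow⟩

theorem neg (hp : HeightLe B p) : HeightLe B (-p) := ⟨by simpa using hp.1, by simpa using hp.2⟩

theorem inv (hp : HeightLe B p) : HeightLe B p⁻¹ := by
  rcases eq_or_ne p 0 with rfl | h0
  · simpa using zero B
  · refine of_eq_div (a := p.den) (b := p.num) (Rat.num_ne_zero.2 h0) ?_ hp.1 hp.2
    conv_lhs => rw [← Rat.num_div_den p]
    simp

theorem mul (hp : HeightLe B p) (hq : HeightLe C q) : HeightLe (B + C) (p * q) := by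
  refine of_eq_div (a := p.num * q.num) (b := (p.den * q.den : ℕ)) ?_ ?_ ?_ ?_
  · exact_mod_cast mul_ne_zero p.den_ne_zero q.den_ne_zero
  · conv_lhs => rw [← Rat.num_div_den p, ← Rat.num_div_den q]
    push_cast
    rw [div_mul_div_comm]
  · rw [Int.natAbs_mul, pow_add]; exact Nat.mul_le_mul hp.2 hq.2
  · rw [Int.natAbs_natCast, pow_add]; exact Nat.mul_le_mul hp.1 hq.1

theorem div (hp : HeightLe B p) (hq : HeightLe C q) : HeightLe (B + C) (p / q) := by
  rw [div_eq_mul_inv]; exact hp.mul hq.inv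

theorem add (hp : HeightLe B p) (hq : HeightLe C q) : HeightLe (B + C + 1) (p + q) := by
  refine of_eq_div (a := p.num * q.den + p.den * q.num) (b := (p.den * q.den : ℕ)) ?_ ?_ ?_ ?_
  · exact_mod_cast mul_ne_zero p.den_ne_zero q.den_ne_zero
  · conv_lhs => rw [← Rat.num_div_den p, ← Rat.num_div_den q]
    push_cast
    rw [div_add_div _ _ (by exact_mod_cast p.den_ne_zero) (by exact_mod_cast q.den_ne_zero)]
  · refine (Int.natAbs_add_le _ _).trans ?_
    rw [Int.natAbs_mul, Int.natAbs_mul, pow_succ, pow_add, mul_two]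
    exact Nat.add_le_add (Nat.mul_le_mul hp.2 hq.1) (Nat.mul_le_mul hp.1 hq.2)
  · rw [Int.natAbs_natCast, pow_succ, pow_add]
    exact (Nat.mul_le_mul hp.1 hq.1).trans (Nat.le_mul_of_pos_right _ two_pos)

theorem sub (hp : HeightLe B p) (hq : HeightLe C q) : HeightLe (B + C + 1) (p - q) := by
  rw [sub_eq_add_neg]; exact hp.add hq.neg

end HeightLe

/-! ### Evaluation of expressions -/

/-- The expression `e` evaluates to `v` within the size bound `L`. -/
def NatExpr.Yields (L : ℕ) (s : State) (e : NatExpr) (v : ℕ) : Prop :=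
  e.Fits L s ∧ e.eval s = v

/-- The expression `e` evaluates to `q`, of height at most `B`, within the size bound `L`. -/
def RatExpr.Yields (L : ℕ) (s : State) (e : RatExpr) (B : ℕ) (q : ℚ) : Prop :=
  e.Fits L s ∧ e.eval s = q ∧ HeightLe B q

/-- The scalar variable in cell `0` of the natural number array `c`. -/
def var (c : ℕ) : NatExpr := NatExpr.get c (NatExpr.const 0)

theorem yields_zero (L : ℕ) (s : State) : (NatExpr.const 0).Yields L s 0 :=
  ⟨by simp [NatExpr.Fits], rfl⟩

theorem yields_var {L : ℕ} {s : State} {c v : ℕ} (h : s.nat c 0 = v) (hv : Nat.size v ≤ L) :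
    (var c).Yields L s v := by
  refine ⟨⟨by simp [NatExpr.Fits], ?_⟩, h⟩
  simpa [NatExpr.eval, h] using hv

theorem size_mono_le {k N L : ℕ} (h : k ≤ N) (hN : Nat.size N ≤ L) : Nat.size k ≤ L :=
  (Nat.size_le_size h).trans hN

namespace RatExpr.Yields

variable {L : ℕ} {s : State} {e f : RatExpr} {B C : ℕ} {p q : ℚ}

theorem const (hq : HeightLe B q) (hL : 2 * B + 3 ≤ L) : (RatExpr.const q).Yields L s B q :=
  ⟨hq.ratSize_le.trans hL, rfl, hq⟩

theorem get {a : ℕ} {i j : NatExpr} {k l : ℕ} (hi : i.Yields L s k) (hj : j.Yields L s l)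
    (hv : s.rat a k l = q) (hq : HeightLe B q) (hL : 2 * B + 3 ≤ L) :
    (RatExpr.get a i j).Yields L s B q := by
  have h : (RatExpr.get a i j).eval s = q := by rw [RatExpr.eval, hi.2, hj.2, hv]
  exact ⟨⟨hi.1, hj.1, by rw [h]; exact hq.ratSize_le.trans hL⟩, h, hq⟩

theorem add (he : e.Yields L s B p) (hf : f.Yields L s C q) (hL : 2 * (B + C + 1) + 3 ≤ L) :
    (RatExpr.add e f).Yields L s (B + C + 1) (p + q) := by
  have h : (RatExpr.add e f).eval s = p + q := by rw [RatExpr.eval, he.2.1, hf.2.1]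
  have h' := he.2.2.add hf.2.2
  exact ⟨⟨he.1, hf.1, by rw [h]; exact h'.ratSize_le.trans hL⟩, h, h'⟩

theorem sub (he : e.Yields L s B p) (hf : f.Yields L s C q) (hL : 2 * (B + C + 1) + 3 ≤ L) :
    (RatExpr.sub e f).Yields L s (B + C + 1) (p - q) := by
  have h : (RatExpr.sub e f).eval s = p - q := by rw [RatExpr.eval, he.2.1, hf.2.1]
  have h' := he.2.2.sub hf.2.2
  exact ⟨⟨he.1, hf.1, by rw [h]; exact h'.ratSize_le.trans hL⟩, h, h'⟩

theorem mul (he : e.Yields L s B p) (hf : f.Yields L s C q) (hL : 2 * (B + C) + 3 ≤ L) :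
    (RatExpr.mul e f).Yields L s (B + C) (p * q) := by
  have h : (RatExpr.mul e f).eval s = p * q := by rw [RatExpr.eval, he.2.1, hf.2.1]
  have h' := he.2.2.mul hf.2.2
  exact ⟨⟨he.1, hf.1, by rw [h]; exact h'.ratSize_le.trans hL⟩, h, h'⟩

theorem div (he : e.Yields L s B p) (hf : f.Yields L s C q) (h0 : q ≠ 0)
    (hL : 2 * (B + C) + 3 ≤ L) : (RatExpr.div e f).Yields L s (B + C) (p / q) := by
  have h : (RatExpr.div e f).eval s = p / q := by rw [RatExpr.eval, he.2.1, hf.2.1]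
  have h' := he.2.2.div hf.2.2
  exact ⟨⟨he.1, hf.1, by rw [hf.2.1]; exact h0, by rw [h]; exact h'.ratSize_le.trans hL⟩, h, h'⟩

end RatExpr.Yields

/-- The test `e < f`. -/
def Test.ratLt (e f : RatExpr) : Test := Test.not (Test.ratLe f e)

/-- The test `e ≠ 0`. -/
def Test.ratNeZero (e : RatExpr) : Test :=
  Test.not (Test.and (Test.ratLe e (RatExpr.const 0)) (Test.ratLe (RatExpr.const 0) e))

theorem Test.ratLt_spec {L : ℕ} {s : State} {e f : RatExpr} {B C : ℕ} {p q : ℚ}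
    (he : e.Yields L s B p) (hf : f.Yields L s C q) :
    (Test.ratLt e f).Fits L s ∧ (Test.ratLt e f).eval s = decide (p < q) := by
  refine ⟨⟨hf.1, he.1⟩, ?_⟩
  simp [Test.ratLt, Test.eval, he.2.1, hf.2.1]
  by_cases h : p < q
  · simp [h, not_le.2 h]
  · simp [h, not_lt.1 h]

theorem Test.ratNeZero_spec {L : ℕ} {s : State} {e : RatExpr} {B : ℕ} {p : ℚ}
    (he : e.Yields L s B p) (hL : 3 ≤ L) :
    (Test.ratNeZero e).Fits L s ∧ (Test.ratNeZero e).eval s = decide (p ≠ 0) := by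
  have h0 : (RatExpr.const 0).Fits L s := (RatExpr.Yields.const (HeightLe.zero 0) hL).1
  refine ⟨⟨⟨he.1, h0⟩, h0, he.1⟩, ?_⟩
  simp only [Test.ratNeZero, Test.eval, he.2.1, RatExpr.eval]
  by_cases h : p = 0
  · simp [h]
  · rcases lt_or_gt_of_ne h with h' | h'
    · simp [h, not_le.2 h']
    · simp [h, not_le.2 h']

/-! ### Runs with a time bound and a postcondition -/

/-- The program `p` halts from `s` after at most `T` steps, in a state with the property `Q`. -/
def Halts (L : ℕ) (p : Program) (s : State) (T : ℕ) (Q : State → Prop) : Prop :=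
  ∃ t s', Runs L p s t s' ∧ t ≤ T ∧ Q s'

namespace Halts

variable {L : ℕ} {p q : Program} {s : State} {T T' : ℕ} {Q Q' : State → Prop}

theorem mono (h : Halts L p s T Q) (hT : T ≤ T') (hQ : ∀ s', Q s' → Q' s') :
    Halts L p s T' Q' := by
  obtain ⟨t, s', h1, h2, h3⟩ := h
  exact ⟨t, s', h1, h2.trans hT, hQ _ h3⟩

theorem skip (h : Q s) : Halts L Program.skip s 1 Q := ⟨_, _, Runs.skip s, le_rfl, h⟩

theorem seq (hp : Halts L p s T Q) (hq : ∀ s', Q s' → Halts L q s' T' Q') :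
    Halts L (Program.seq p q) s (T + T') Q' := by
  obtain ⟨t, s', h1, h2, h3⟩ := hp
  obtain ⟨t', s'', h1', h2', h3'⟩ := hq s' h3
  exact ⟨_, _, Runs.seq h1 h1', Nat.add_le_add h2 h2', h3'⟩

theorem setNat {a : ℕ} {i e : NatExpr} {k v : ℕ} (hi : i.Yields L s k) (he : e.Yields L s v)
    (h : Q (s.setNat a k v)) :
    Halts L (Program.setNat a i e) s (i.cost + e.cost + 1) Q :=
  ⟨_, _, Runs.setNat a i e s hi.1 he.1, le_rfl, by rw [hi.2, he.2]; exact h⟩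

theorem setRat {a : ℕ} {i j : NatExpr} {e : RatExpr} {k l B : ℕ} {v : ℚ} (hi : i.Yields L s k)
    (hj : j.Yields L s l) (he : e.Yields L s B v) (h : Q (s.setRat a k l v)) :
    Halts L (Program.setRat a i j e) s (i.cost + j.cost + e.cost + 1) Q :=
  ⟨_, _, Runs.setRat a i j e s hi.1 hj.1 he.1, le_rfl, by rw [hi.2, hj.2, he.2.1]; exact h⟩

theorem ite {b : Test} {P : Prop} [Decidable P] (hb : b.Fits L s ∧ b.eval s = decide P)
    (hp : P → Halts L p s T Q) (hq : ¬ P → Halts L q s T Q) :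
    Halts L (Program.ite b p q) s (b.cost + 1 + T) Q := by
  by_cases h : P
  · obtain ⟨t, s', h1, h2, h3⟩ := hp h
    exact ⟨_, s', Runs.ite_true q hb.1 (by simp [hb.2, h]) h1, Nat.add_le_add_left h2 _, h3⟩
  · obtain ⟨t, s', h1, h2, h3⟩ := hq h
    exact ⟨_, s', Runs.ite_false p hb.1 (by simp [hb.2, h]) h1, Nat.add_le_add_left h2 _, h3⟩

end Halts

/-- Run `body` with the counter in cell `0` of the array `c` going from `0` to the value of the
variable `b`, exclusive. -/
def forLoop (c b : ℕ) (body : Program) : Program :=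
  Program.seq (Program.setNat c (NatExpr.const 0) (NatExpr.const 0))
    (Program.loop (Test.not (Test.natLe (var b) (var c)))
      (Program.seq body
        (Program.setNat c (NatExpr.const 0) (NatExpr.add (var c) (NatExpr.const 1)))))

@[simp] theorem setNat_nat_self (s : State) (c v : ℕ) : (s.setNat c 0 v).nat c 0 = v := by
  simp [State.setNat]

theorem setNat_nat_of_ne (s : State) {c d : ℕ} (i v : ℕ) (h : d ≠ c) :
    (s.setNat c i v).nat d = s.nat d := by
  simp [State.setNat, h]

@[simp] theorem setNat_rat (s : State) (c i v : ℕ) : (s.setNat c i v).rat = s.rat := rfl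

theorem setRat_rat_of_ne (s : State) {a b : ℕ} (i j : ℕ) (q : ℚ) (h : b ≠ a) :
    (s.setRat a i j q).rat b = s.rat b := by
  simp [State.setRat, h]

theorem setRat_rat_self (s : State) (a i j : ℕ) (q : ℚ) (k l : ℕ) :
    (s.setRat a i j q).rat a k l = if k = i ∧ l = j then q else s.rat a k l := by
  simp only [State.setRat, Function.update_self]
  by_cases hk : k = i
  · subst hk
    by_cases hl : l = j
    · subst hl; simp
    · simp [hl]
  · simp [hk]

/-- The Hoare rule for counting loops. The invariant must survive writes to the counter, and the
body must leave the counter as it found it. The constant `14` generously covers the test, the jump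
and the increment of one round (13 steps), and likewise the initialization plus the last failing
test. The time is stated with `K ≥ N` so that bounds depend on one parameter only. -/
theorem halts_forLoop {L c b N K T : ℕ} {body : Program} {s : State} (Inv : ℕ → State → Prop)
    (hNL : Nat.size N ≤ L) (hL : 1 ≤ L) (hNK : N ≤ K)
    (hb : ∀ k s', Inv k s' → s'.nat b 0 = N)
    (hc : ∀ k s' v, Inv k s' → Inv k (s'.setNat c 0 v))
    (h0 : Inv 0 s)
    (hstep : ∀ k < N, ∀ s', s'.nat c 0 = k → Inv k s' →
      Halts L body s' T (fun s'' => s''.nat c 0 = k ∧ Inv (k + 1) s'')) :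
    Halts L (forLoop c b body) s (K * (T + 14) + 14) (Inv N) := by
  have htest : ∀ k s', k ≤ N → s'.nat c 0 = k → Inv k s' →
      (Test.not (Test.natLe (var b) (var c))).Fits L s' ∧
      (Test.not (Test.natLe (var b) (var c))).eval s' = decide (k < N) := by
    intro k s' hk h1 h2
    have y1 := yields_var (L := L) (hb k s' h2) hNL
    have y2 := yields_var (L := L) h1 (size_mono_le hk hNL)
    refine ⟨⟨y1.1, y2.1⟩, ?_⟩
    simp only [Test.eval, y1.2, y2.2]
    by_cases h : k < N
    · simp [h]
    · simp [h, not_lt.1 h]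
  have key : ∀ d k, k + d = N → ∀ s', s'.nat c 0 = k → Inv k s' →
      Halts L (Program.loop (Test.not (Test.natLe (var b) (var c)))
        (Program.seq body
          (Program.setNat c (NatExpr.const 0) (NatExpr.add (var c) (NatExpr.const 1)))))
        s' (d * (T + 14) + 7) (Inv N) := by
    intro d
    induction d with
    | zero =>
      intro k hk s' h1 h2
      obtain ⟨hf, he⟩ := htest k s' (by omega) h1 h2
      have hkN : k = N := by omega
      refine ⟨_, s', Runs.loop_false _ hf (by simp [he, hkN]), ?_, hkN ▸ h2⟩
      simp [Test.cost, NatExpr.cost, var]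
    | succ d ih =>
      intro k hk s' h1 h2
      obtain ⟨hf, he⟩ := htest k s' (by omega) h1 h2
      obtain ⟨t, s1, r1, ht1, hs1, hi1⟩ := hstep k (by omega) s' h1 h2
      have y : (NatExpr.add (var c) (NatExpr.const 1)).Yields L s1 (k + 1) := by
        have yc := yields_var (L := L) hs1 (size_mono_le (show k ≤ N by omega) hNL)
        refine ⟨⟨yc.1, by simpa [NatExpr.Fits] using hL, ?_⟩, ?_⟩
        · simp only [NatExpr.eval, yc.2]
          exact size_mono_le (show k + 1 ≤ N by omega) hNL
        · simp only [NatExpr.eval, yc.2]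
      obtain ⟨t2, s2, r2, ht2, hs2⟩ := Halts.setNat (a := c) (Q := fun x => x = s1.setNat c 0 (k + 1))
        (yields_zero L s1) y rfl
      subst hs2
      obtain ⟨t3, s3, r3, ht3, hs3⟩ := ih (k + 1) (by omega) (s1.setNat c 0 (k + 1)) (by simp)
        (hc _ _ _ hi1)
      refine ⟨_, s3, Runs.loop_true hf (by simp [he]; omega) (Runs.seq r1 r2) r3, ?_, hs3⟩
      simp only [Test.cost, NatExpr.cost, var] at ht2 ⊢
      rw [Nat.succ_mul]
      omega
  refine (Halts.seq (Halts.setNat (Q := fun x => x = s.setNat c 0 0) (yields_zero L s)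
    (yields_zero L s) rfl) (fun s' hs' => ?_)).mono (T := _ + (N * (T + 14) + 7)) ?_ (fun _ h => h)
  · subst hs'
    exact key N 0 (by omega) _ (by simp) (hc _ _ _ h0)
  · simp only [NatExpr.cost]
    have := Nat.mul_le_mul_right (T + 14) hNK
    omega

/-! ### Frames and array filling -/

/-- `s'` differs from `s` only in the natural number arrays in `C` and the rational arrays in
`R`. -/
def Frame (C R : Set ℕ) (s s' : State) : Prop :=
  (∀ c, c ∉ C → s'.nat c = s.nat c) ∧ ∀ a, a ∉ R → s'.rat a = s.rat a

namespace Frame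

variable {C C' R R' : Set ℕ} {s s' s'' : State}

theorem refl (C R : Set ℕ) (s : State) : Frame C R s s := ⟨fun _ _ => rfl, fun _ _ => rfl⟩

theorem trans (h : Frame C R s s') (h' : Frame C R s' s'') : Frame C R s s'' :=
  ⟨fun c hc => (h'.1 c hc).trans (h.1 c hc), fun a ha => (h'.2 a ha).trans (h.2 a ha)⟩

theorem mono (h : Frame C R s s') (hC : C ⊆ C') (hR : R ⊆ R') : Frame C' R' s s' :=
  ⟨fun c hc => h.1 c fun h => hc (hC h), fun a ha => h.2 a fun h => ha (hR h)⟩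

theorem setNat (h : Frame C R s s') {c i v : ℕ} (hc : c ∈ C) : Frame C R s (s'.setNat c i v) :=
  ⟨fun d hd => by rw [setNat_nat_of_ne _ _ _ (by rintro rfl; exact hd hc), h.1 d hd], h.2⟩

theorem setRat (h : Frame C R s s') {a i j : ℕ} {q : ℚ} (ha : a ∈ R) :
    Frame C R s (s'.setRat a i j q) :=
  ⟨h.1, fun d hd => by rw [setRat_rat_of_ne _ _ _ _ (by rintro rfl; exact hd ha), h.2 d hd]⟩

end Frame

/-- Fill the column `col` of the rational array `a`, with as many rows as the variable `b` says,
with the values of the expression `e`, which may use the row counter in array `4`. -/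
def fillColumn (a b : ℕ) (col : NatExpr) (e : RatExpr) : Program :=
  forLoop 4 b (Program.setRat a (var 4) col e)

/-- When `e` is evaluated, the cell about to be written still has its old value. This is made
available to `he` so that `e` may read that cell, which permits updates in place. -/
theorem halts_fillColumn {L a b N K B v : ℕ} {col : NatExpr} {e : RatExpr} {s : State}
    (f : Fin N → ℚ) (hNL : Nat.size N ≤ L) (hL : 1 ≤ L) (hNK : N ≤ K) (hb : s.nat b 0 = N)
    (hb4 : b ≠ 4) (hcol : ∀ s', Frame {4} {a} s s' → col.Yields L s' v)
    (he : ∀ (i : Fin N) s', Frame {4} {a} s s' → s'.nat 4 0 = i → s'.rat a i v = s.rat a i v →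
      e.Yields L s' B (f i)) :
    Halts L (fillColumn a b col e) s (K * (col.cost + e.cost + 17) + 14)
      (fun s' => Frame {4} {a} s s' ∧ (∀ i : Fin N, s'.rat a i v = f i) ∧
        ∀ i j, j ≠ v → s'.rat a i j = s.rat a i j) := by
  refine (halts_forLoop (T := 2 + col.cost + e.cost + 1) (K := K) (N := N)
    (fun k s' => Frame {4} {a} s s' ∧ (∀ i : Fin N, (i : ℕ) < k → s'.rat a i v = f i) ∧
      (∀ i, k ≤ i → s'.rat a i v = s.rat a i v) ∧
      ∀ i j, j ≠ v → s'.rat a i j = s.rat a i j) hNL hL hNK ?_ ?_ ?_ ?_).mono ?_ ?_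
  · intro k s' h
    rw [h.1.1 b (by simpa using hb4), hb]
  · intro k s' w h
    exact ⟨h.1.setNat rfl, h.2⟩
  · exact ⟨Frame.refl _ _ _, fun i hi => absurd hi (Nat.not_lt_zero _), fun _ _ => rfl,
      fun _ _ _ => rfl⟩
  · intro k hk s' h4 ⟨hF, h1, h2, h3⟩
    refine Halts.setRat (yields_var h4 (size_mono_le hk.le hNL)) (hcol s' hF)
      (he ⟨k, hk⟩ s' hF h4 (h2 k le_rfl)) ⟨h4, hF.setRat rfl, ?_, ?_, ?_⟩
    · intro i hi
      rw [setRat_rat_self]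
      split_ifs with hh
      · congr 1; exact Fin.ext hh.1.symm
      · exact h1 i (by omega)
    · intro i hi
      rw [setRat_rat_self, if_neg (by omega)]
      exact h2 i (by omega)
    · intro i j hj
      rw [setRat_rat_self, if_neg (by omega)]
      exact h3 i j hj
  · have : K * (2 + col.cost + e.cost + 1 + 14) = K * (col.cost + e.cost + 17) := by ring
    omega
  · intro s' h
    exact ⟨h.1, fun i => h.2.1 i i.2, h.2.2.2⟩

/-- Fill the rational array `a`, with as many rows and columns as the variables `b` and `b'` say,
with the values of the expression `e`, which may use the counters in arrays `4` and `5`. -/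
def fillMatrix (a b b' : ℕ) (e : RatExpr) : Program :=
  forLoop 5 b' (fillColumn a b (var 5) e)

theorem halts_fillMatrix {L a b b' m n K B : ℕ} {e : RatExpr} {s : State}
    (f : Matrix (Fin m) (Fin n) ℚ) (hmL : Nat.size m ≤ L) (hnL : Nat.size n ≤ L) (hL : 1 ≤ L)
    (hmK : m ≤ K) (hnK : n ≤ K) (hb : s.nat b 0 = m) (hb' : s.nat b' 0 = n)
    (hb4 : b < 4) (hb'4 : b' < 4)
    (he : ∀ (i : Fin m) (j : Fin n) s', Frame {4, 5} {a} s s' → s'.nat 4 0 = i → s'.nat 5 0 = j →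
      s'.rat a i j = s.rat a i j → e.Yields L s' B (f i j)) :
    Halts L (fillMatrix a b b' e) s (K * (K * (e.cost + 19) + 28) + 14)
      (fun s' => Frame {4, 5} {a} s s' ∧ s'.matrix a m n = f) := by
  refine (halts_forLoop (T := K * (e.cost + 19) + 14) (K := K) (N := n)
    (fun k s' => Frame {4, 5} {a} s s' ∧
      (∀ (i : Fin m) (j : Fin n), (j : ℕ) < k → s'.rat a i j = f i j) ∧
      (∀ i j, k ≤ j → s'.rat a i j = s.rat a i j)) hnL hL hnK ?_ ?_ ?_ ?_).mono ?_ ?_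
  · intro k s' h
    rw [h.1.1 b' (by simp; omega), hb']
  · intro k s' w h
    exact ⟨h.1.setNat (by simp), h.2⟩
  · exact ⟨Frame.refl _ _ _, fun i j hi => absurd hi (Nat.not_lt_zero _), fun _ _ _ => rfl⟩
  · intro k hk s' h5 ⟨hF, h1, h2⟩
    have sub : ({4} : Set ℕ) ⊆ {4, 5} := by simp
    refine (halts_fillColumn (B := B) (v := k) (K := K) (fun i => f i ⟨k, hk⟩) hmL hL hmK ?_
      (by omega) ?_ ?_).mono ?_ ?_
    · rw [hF.1 b (by simp; omega), hb]
    · intro s'' h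
      exact yields_var (by rw [h.1 5 (by simp), h5]) (size_mono_le hk.le hnL)
    · intro i s'' h h4 hcell
      exact he i ⟨k, hk⟩ s'' (hF.trans (h.mono sub subset_rfl)) h4
        (by rw [h.1 5 (by simp), h5]) (by simp only; rw [hcell, h2 i k le_rfl])
    · simp only [var, NatExpr.cost]
      have : K * (1 + 1 + e.cost + 17) = K * (e.cost + 19) := by ring
      omega
    · intro s'' ⟨h, hcol, hoth⟩
      refine ⟨by rw [h.1 5 (by simp), h5], hF.trans (h.mono sub subset_rfl), ?_, ?_⟩
      · intro i j hj
        rcases Nat.lt_succ_iff_lt_or_eq.1 hj with hj' | hj'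
        · rw [hoth _ _ (by omega), h1 i j hj']
        · subst hj'; exact hcol i
      · intro i j hj
        rw [hoth _ _ (by omega), h2 i j (by omega)]
  · exact le_of_eq (by ring)
  · intro s' h
    refine ⟨h.1, ?_⟩
    ext i j
    exact h.2.1 i j j.2

end RationalMachine

namespace BooleanFactorization

open Matrix

/-! ### The bilinear objective -/

section Objective

variable {m n : ℕ}

/-- The bilinear form of `W` at the binary vectors `x` and `y`. -/
def pairValue (W : Matrix (Fin m) (Fin n) ℚ) (x : Fin m → Bool) (y : Fin n → Bool) : ℚ :=
  ∑ j, ∑ i, bit (x i) * bit (y j) * W i j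

/-- The least value of the bilinear form of `W` with first argument `x`. -/
def columnValue (W : Matrix (Fin m) (Fin n) ℚ) (x : Fin m → Bool) : ℚ :=
  ∑ j, min 0 (∑ i, bit (x i) * W i j)

/-- The positions of the negative entries. -/
def negSupport (u : Fin m → ℚ) : Fin m → Bool := fun i => decide (u i < 0)

theorem bit_eq_ite (p : Prop) [Decidable p] : bit (decide p) = if p then 1 else 0 := by
  by_cases h : p <;> simp [bit, h]

theorem pairValue_eq_sum (W : Matrix (Fin m) (Fin n) ℚ) (x : Fin m → Bool) (y : Fin n → Bool) :
    pairValue W x y = ∑ j, bit (y j) * ∑ i, bit (x i) * W i j := by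
  refine Finset.sum_congr rfl fun j _ => ?_
  rw [Finset.mul_sum]
  exact Finset.sum_congr rfl fun i _ => by ring

theorem pairValue_eq_sum' (W : Matrix (Fin m) (Fin n) ℚ) (x : Fin m → Bool) (y : Fin n → Bool) :
    pairValue W x y = ∑ i, bit (x i) * (W *ᵥ fun j => bit (y j)) i := by
  rw [pairValue, Finset.sum_comm]
  refine Finset.sum_congr rfl fun i _ => ?_
  rw [mulVec, dotProduct, Finset.mul_sum]
  exact Finset.sum_congr rfl fun j _ => by ring

theorem min_zero_le_bit_mul (b : Bool) (q : ℚ) : min 0 q ≤ bit b * q := by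
  cases b <;> simp [bit]

theorem bit_neg_mul (q : ℚ) : bit (decide (q < 0)) * q = min 0 q := by
  rw [bit_eq_ite]
  split_ifs with h
  · rw [min_eq_right h.le, one_mul]
  · rw [min_eq_left (not_lt.1 h), zero_mul]

theorem columnValue_le_pairValue (W : Matrix (Fin m) (Fin n) ℚ) (x : Fin m → Bool)
    (y : Fin n → Bool) : columnValue W x ≤ pairValue W x y := by
  rw [pairValue_eq_sum]
  exact Finset.sum_le_sum fun j _ => min_zero_le_bit_mul _ _

theorem pairValue_negSupport (W : Matrix (Fin m) (Fin n) ℚ) (x : Fin m → Bool) :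
    pairValue W x (negSupport fun j => ∑ i, bit (x i) * W i j) = columnValue W x := by
  rw [pairValue_eq_sum]
  exact Finset.sum_congr rfl fun j _ => bit_neg_mul _

theorem pairValue_mulVec_negSupport_le (W : Matrix (Fin m) (Fin n) ℚ) (x : Fin m → Bool)
    (y : Fin n → Bool) :
    pairValue W (negSupport (W *ᵥ fun j => bit (y j))) y ≤ pairValue W x y := by
  rw [pairValue_eq_sum', pairValue_eq_sum']
  refine Finset.sum_le_sum fun i _ => ?_
  rw [negSupport, bit_neg_mul]
  exact min_zero_le_bit_mul _ _

/-- Take `y₀` from an optimal pair. Replacing `x₀` by the best answer to `y₀`, and then `y₀` by the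
best answer to the new first vector, can only lower the value. -/
theorem exists_columnValue_mulVec_le (W : Matrix (Fin m) (Fin n) ℚ) :
    ∃ y₀ : Fin n → Bool, ∀ x y,
      columnValue W (negSupport (W *ᵥ fun j => bit (y₀ j))) ≤ pairValue W x y := by
  obtain ⟨⟨x₀, y₀⟩, h⟩ := Finite.exists_min
    (fun p : (Fin m → Bool) × (Fin n → Bool) => pairValue W p.1 p.2)
  exact ⟨y₀, fun x y => (columnValue_le_pairValue _ _ y₀).trans
    ((pairValue_mulVec_negSupport_le W x₀ y₀).trans (h (x, y)))⟩

theorem squaredError_booleanProduct (A : Matrix (Fin m) (Fin n) ℚ) (x : Fin m → Bool)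
    (y : Fin n → Bool) :
    squaredError A (booleanProduct (fun _ : Fin 1 => x) (fun _ : Fin 1 => y)) =
      ∑ i, ∑ j, A i j ^ 2 + pairValue (Matrix.of fun i j => 1 - (A i j + A i j)) x y := by
  rw [squaredError, pairValue, Finset.sum_comm (s := Finset.univ (α := Fin n)),
    ← Finset.sum_add_distrib]
  refine Finset.sum_congr rfl fun i _ => ?_
  rw [← Finset.sum_add_distrib]
  refine Finset.sum_congr rfl fun j _ => ?_
  cases hx : x i <;> cases hy : y j <;> simp [booleanProduct, bit, hx, hy]
  ring

theorem exists_eq_booleanProduct_of_rank_le_one {B : Matrix (Fin m) (Fin n) Bool}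
    (hB : booleanRank B ≤ 1) :
    ∃ x y, B = booleanProduct (fun _ : Fin 1 => x) (fun _ : Fin 1 => y) := by
  obtain ⟨u, v, h⟩ := exists_eq_booleanProduct B
  generalize booleanRank B = k at u v h hB
  obtain rfl | rfl : k = 0 ∨ k = 1 := by omega
  · refine ⟨fun _ => false, fun _ => false, ?_⟩
    rw [h]; ext i j; simp [booleanProduct]
  · refine ⟨u 0, v 0, ?_⟩
    rw [h]; ext i j; simp [booleanProduct]

theorem booleanRank_booleanProduct_le (x : Fin m → Bool) (y : Fin n → Bool) :
    booleanRank (booleanProduct (fun _ : Fin 1 => x) (fun _ : Fin 1 => y)) ≤ 1 :=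
  Nat.sInf_le ⟨_, _, rfl⟩

theorem booleanRank_booleanProduct_eq_one_iff (x : Fin m → Bool) (y : Fin n → Bool) :
    booleanRank (booleanProduct (fun _ : Fin 1 => x) (fun _ : Fin 1 => y)) = 1 ↔
      (∃ i, x i = true) ∧ ∃ j, y j = true := by
  constructor
  · intro h
    by_contra hne
    have h0 : booleanRank (booleanProduct (fun _ : Fin 1 => x) (fun _ : Fin 1 => y)) ≤ 0 := by
      refine Nat.sInf_le ⟨Fin.elim0, Fin.elim0, ?_⟩
      ext i j
      have : ¬ (x i = true ∧ y j = true) := fun hh => hne ⟨⟨i, hh.1⟩, j, hh.2⟩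
      simpa [booleanProduct] using this
    omega
  · rintro ⟨⟨i, hi⟩, j, hj⟩
    refine le_antisymm (booleanRank_booleanProduct_le x y) (Nat.one_le_iff_ne_zero.2 fun h0 => ?_)
    obtain ⟨u, v, h⟩ := exists_eq_booleanProduct
      (booleanProduct (fun _ : Fin 1 => x) (fun _ : Fin 1 => y))
    have h1 : booleanProduct (fun _ : Fin 1 => x) (fun _ : Fin 1 => y) i j = true := by
      simp [booleanProduct, hi, hj]
    rw [h] at h1
    obtain ⟨p, -⟩ := of_decide_eq_true h1
    exact (h0 ▸ p).elim0

/-- This makes every accepted improvement feasible for Boolean rank exactly one without any further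
test. -/
theorem exists_true_of_pairValue_neg {W : Matrix (Fin m) (Fin n) ℚ} {x : Fin m → Bool}
    {y : Fin n → Bool} (h : pairValue W x y < 0) : (∃ i, x i = true) ∧ ∃ j, y j = true := by
  by_contra hne
  refine h.ne (Finset.sum_eq_zero fun j _ => Finset.sum_eq_zero fun i _ => ?_)
  by_cases hx : x i = true
  · by_cases hy : y j = true
    · exact absurd ⟨⟨i, hx⟩, j, hy⟩ hne
    · simp [bit, hy]
  · simp [bit, hx]

theorem pairValue_single (W : Matrix (Fin m) (Fin n) ℚ) (i : Fin m) (j : Fin n) :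
    pairValue W (fun a => decide (a = i)) (fun b => decide (b = j)) = W i j := by
  simp [pairValue, bit_eq_ite]

/-- For nonnegative `W` the form is a sum of nonnegative terms, one of which is the selected entry.
So a least entry is an optimal nonzero solution. -/
theorem entry_le_pairValue {W : Matrix (Fin m) (Fin n) ℚ} (hW : ∀ i j, 0 ≤ W i j)
    {x : Fin m → Bool} {y : Fin n → Bool} {i : Fin m} {j : Fin n} (hx : x i = true)
    (hy : y j = true) : W i j ≤ pairValue W x y := by
  have h0 : ∀ a b, 0 ≤ bit (x a) * bit (y b) * W a b := fun a b =>
    mul_nonneg (mul_nonneg (by unfold bit; split_ifs <;> simp) (by unfold bit; split_ifs <;> simp))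
      (hW a b)
  calc W i j = bit (x i) * bit (y j) * W i j := by simp [bit, hx, hy]
    _ ≤ ∑ a, bit (x a) * bit (y j) * W a j :=
      Finset.single_le_sum (f := fun a => bit (x a) * bit (y j) * W a j)
        (fun a _ => h0 a j) (Finset.mem_univ i)
    _ ≤ _ := Finset.single_le_sum (f := fun b => ∑ a, bit (x a) * bit (y b) * W a b)
        (fun b _ => Finset.sum_nonneg fun a _ => h0 a b) (Finset.mem_univ j)

end Objective

/-! ### Elimination -/

section Elimination

variable {m n : ℕ}

/-- One step of rank reduction with the pivot `(i, j)`. -/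
def eliminate (M : Matrix (Fin m) (Fin n) ℚ) (i : Fin m) (j : Fin n) : Matrix (Fin m) (Fin n) ℚ :=
  Matrix.of fun a b => M a b - M a j * M i b / M i j

/-- The change of `h` by a multiple of column `j` of `M` that sets the entry `i` to `q`. -/
def adjust (M : Matrix (Fin m) (Fin n) ℚ) (h : Fin m → ℚ) (i : Fin m) (j : Fin n) (q : ℚ) :
    Fin m → ℚ :=
  fun a => h a + M a j / M i j * (q - h i)

theorem eliminate_mulVec (M : Matrix (Fin m) (Fin n) ℚ) (i : Fin m) (j : Fin n) (z : Fin n → ℚ)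
    (a : Fin m) : (eliminate M i j *ᵥ z) a = (M *ᵥ z) a - M a j / M i j * (M *ᵥ z) i := by
  simp only [mulVec, dotProduct, eliminate, of_apply, Finset.mul_sum, ← Finset.sum_sub_distrib]
  exact Finset.sum_congr rfl fun b _ => by ring

/-- Elimination subtracts multiples of column `j` from the columns, so it amounts to a change of the
argument `z` in direction `j`. -/
theorem range_eliminate_le (M : Matrix (Fin m) (Fin n) ℚ) (i : Fin m) (j : Fin n) :
    LinearMap.range (eliminate M i j).mulVecLin ≤ LinearMap.range M.mulVecLin := by
  rintro _ ⟨z, rfl⟩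
  refine ⟨z - ((M *ᵥ z) i / M i j) • Pi.single j 1, ?_⟩
  ext a
  rw [mulVecLin_apply, mulVecLin_apply, eliminate_mulVec, mulVec_sub, mulVec_smul,
    mulVec_single_one]
  simp only [Pi.sub_apply, Pi.smul_apply, smul_eq_mul, col_apply]
  ring

/-- After elimination every vector of the range vanishes at `i`, whereas column `j` of `M` does not;
the inclusion of ranges is therefore strict. -/
theorem rank_eliminate_lt {M : Matrix (Fin m) (Fin n) ℚ} {i : Fin m} {j : Fin n}
    (h : M i j ≠ 0) : (eliminate M i j).rank < M.rank := by
  refine Submodule.finrank_lt_finrank_of_lt (lt_of_le_of_ne (range_eliminate_le M i j) ?_)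
  intro heq
  have hmem : M *ᵥ Pi.single j 1 ∈ LinearMap.range (eliminate M i j).mulVecLin := by
    rw [heq]; exact ⟨Pi.single j 1, rfl⟩
  obtain ⟨z, hz⟩ := hmem
  have := congrFun hz i
  rw [mulVecLin_apply, eliminate_mulVec, mulVec_single_one, col_apply, div_self h, one_mul,
    sub_self] at this
  exact h this.symm

/-- The vectors that arise from `h` by at most `d` elimination steps in `M`, where each time the
entry at the pivot row is set to `0` or `-1`. -/
def Reachable : ℕ → Matrix (Fin m) (Fin n) ℚ → (Fin m → ℚ) → (Fin m → ℚ) → Prop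
  | 0, _, h, u => h = u
  | d + 1, M, h, u => h = u ∨ ∃ i j, M i j ≠ 0 ∧ ∃ q, (q = 0 ∨ q = -1) ∧
      Reachable d (eliminate M i j) (adjust M h i j q) u

/-- The invariant is that `u - h` lies in the range of the current matrix and this range lies in
`U`. Each round fixes one more entry of `u` and lowers the rank; once the matrix is zero, `h = u`.
-/
theorem reachable_of_rank_le {U : Submodule ℚ (Fin m → ℚ)} {u : Fin m → ℚ}
    (hu : ∀ v ∈ U, (∀ i, u i = 0 ∨ u i = -1 → v i = 0) → v = 0) (d : ℕ) :
    ∀ (M : Matrix (Fin m) (Fin n) ℚ) (h : Fin m → ℚ), M.rank ≤ d →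
      LinearMap.range M.mulVecLin ≤ U → (∃ z, u = h + M *ᵥ z) → Reachable d M h u := by
  have h0 : ∀ (M : Matrix (Fin m) (Fin n) ℚ) (h : Fin m → ℚ), M = 0 →
      (∃ z, u = h + M *ᵥ z) → h = u := by
    rintro M h rfl ⟨z, hz⟩
    simpa using hz.symm
  induction d with
  | zero =>
    intro M h hr _ hz
    refine h0 M h ?_ hz
    have h1 : LinearMap.range M.mulVecLin = ⊥ := Submodule.finrank_eq_zero.1 (Nat.le_zero.1 hr)
    ext i j
    have h2 := congrFun (LinearMap.congr_fun (LinearMap.range_eq_bot.1 h1) (Pi.single j 1)) i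
    rwa [mulVecLin_apply, mulVec_single_one] at h2
  | succ d ih =>
    intro M h hr hU hz
    by_cases hM : M = 0
    · exact Or.inl (h0 M h hM hz)
    · right
      obtain ⟨j, hj⟩ : ∃ j, M *ᵥ Pi.single j 1 ≠ 0 := by
        by_contra hne
        push Not at hne
        refine hM (Matrix.ext fun i j => ?_)
        have := congrFun (hne j) i
        rwa [mulVec_single_one] at this
      -- A nonzero column lies in `U`, so it cannot vanish at all entries that determine `u`; the
      -- pivot row is one where it does not.
      obtain ⟨i, hi, hij⟩ : ∃ i, (u i = 0 ∨ u i = -1) ∧ M i j ≠ 0 := by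
        by_contra hne
        push Not at hne
        refine hj (hu _ (hU ⟨Pi.single j 1, rfl⟩) fun i hi => ?_)
        rw [mulVec_single_one]
        exact hne i hi
      refine ⟨i, j, hij, u i, hi, ih _ _ ?_ ((range_eliminate_le M i j).trans hU) ?_⟩
      · have := rank_eliminate_lt hij
        omega
      · obtain ⟨z, hz⟩ := hz
        refine ⟨z, funext fun a => ?_⟩
        have ha := congrFun hz a
        have hi' := congrFun hz i
        simp only [Pi.add_apply] at ha hi' ⊢
        rw [eliminate_mulVec, adjust, ha, hi']
        ring

/-- Every vector of a subspace has the same negative support as a vector of the subspace that is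
determined by its entries `0` and `-1`. -/
theorem exists_basic_negSupport_eq (U : Submodule ℚ (Fin m → ℚ)) {u₀ : Fin m → ℚ} (h₀ : u₀ ∈ U) :
    ∃ u ∈ U, negSupport u = negSupport u₀ ∧
      ∀ v ∈ U, (∀ i, u i = 0 ∨ u i = -1 → v i = 0) → v = 0 := by
  classical
  -- `g w i` is the slack of `w` at `i`
  set N : Fin m → Prop := fun i => u₀ i < 0 with hN
  set g : (Fin m → ℚ) → Fin m → ℚ := fun w i => if N i then -1 - w i else w i with hg
  -- The linear part of the affine map `g`.
  set δ : (Fin m → ℚ) → Fin m → ℚ := fun w i => if N i then -w i else w i with hδ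
  have hgadd : ∀ w v (c : ℚ) i, g (w + c • v) i = g w i + c * δ v i := by
    intro w v c i
    simp only [hg, hδ, Pi.add_apply, Pi.smul_apply, smul_eq_mul]
    split_ifs <;> ring
  set F : Set (Fin m → ℚ) := {w | w ∈ U ∧ ∀ i, 0 ≤ g w i} with hF
  have hneg : ∀ w ∈ F, negSupport w = negSupport u₀ := by
    intro w hw
    funext i
    have := hw.2 i
    simp only [hg, hN] at this
    simp only [negSupport, decide_eq_decide]
    split_ifs at this with h
    · exact ⟨fun _ => h, fun _ => by linarith⟩
    · exact ⟨fun h' => absurd this (not_le.2 h'), fun h' => absurd h' h⟩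
  -- Scaling `u₀` by a factor at least every `-1 / u₀ i` pushes its negative entries down to `-1` or
  -- below.
  have hne : ∃ w, w ∈ F := by
    obtain ⟨c, hc⟩ : ∃ c : ℚ, ∀ i, N i → (u₀ i)⁻¹ * -1 ≤ c := by
      obtain ⟨c, hc⟩ := (Set.finite_range fun i => (u₀ i)⁻¹ * -1).bddAbove
      exact ⟨c, fun i _ => hc ⟨i, rfl⟩⟩
    refine ⟨max c 0 • u₀, U.smul_mem _ h₀, fun i => ?_⟩
    simp only [hg, Pi.smul_apply, smul_eq_mul]
    split_ifs with h
    · have h1 := (hc i h).trans (le_max_left c 0)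
      have h2 := mul_le_mul_of_nonpos_right h1 (le_of_lt h)
      have h3 : (u₀ i)⁻¹ * -1 * u₀ i = -1 := by
        have : u₀ i ≠ 0 := ne_of_lt h
        field_simp
      linarith
    · exact mul_nonneg (le_max_right _ _) (not_lt.1 h)
  -- A feasible point with the most tight constraints plays the role of the vertex.
  obtain ⟨u, huF, hmax⟩ : ∃ u ∈ F, ∀ w ∈ F,
      (Finset.univ.filter fun i => g w i = 0).card ≤
        (Finset.univ.filter fun i => g u i = 0).card := by
    have hfin : ((fun w => (Finset.univ.filter fun i => g w i = 0).card) '' F).Finite :=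
      (Set.finite_Iic m).subset (by
        rintro _ ⟨w, _, rfl⟩
        simpa using Finset.card_le_univ (Finset.univ.filter fun i => g w i = 0))
    obtain ⟨w₀, hw₀⟩ := hne
    obtain ⟨_, ⟨u, hu, rfl⟩, hmax⟩ := hfin.exists_maximal ⟨_, w₀, hw₀, rfl⟩
    refine ⟨u, hu, fun w hw => ?_⟩
    exact le_of_not_gt fun hlt => absurd (hmax ⟨w, hw, rfl⟩ hlt.le) (not_le.2 hlt)
  refine ⟨u, huF.1, hneg u huF, fun v hv hvT => ?_⟩
  have hT : ∀ i, g u i = 0 → v i = 0 := fun i hi => hvT i (by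
    simp only [hg] at hi
    split_ifs at hi
    · right; linarith
    · left; exact hi)
  -- A ratio test. If moving along `v` decreases some slack, move until the first slack reaches
  -- zero. The tight constraints stay tight because `v` vanishes there, and one is gained, against
  -- maximality. Applied to `v` and `-v` this gives `v = 0`.
  have main : ∀ v ∈ U, (∀ i, g u i = 0 → v i = 0) → ∀ i, 0 ≤ δ v i := by
    intro v hv hT i₁
    by_contra hi₁
    rw [not_le] at hi₁
    obtain ⟨k, hk, hkmin⟩ := Finset.exists_min_image (Finset.univ.filter fun i => δ v i < 0)
      (fun i => g u i / -δ v i) ⟨i₁, by simpa using hi₁⟩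
    simp only [Finset.mem_filter, Finset.mem_univ, true_and] at hk hkmin
    set c := g u k / -δ v k with hc
    have hc0 : 0 ≤ c := div_nonneg (huF.2 k) (by linarith)
    have hgk : g (u + c • v) k = 0 := by
      rw [hgadd, hc, div_neg, neg_mul, div_mul_cancel₀ _ hk.ne, add_neg_cancel]
    have hfeas : u + c • v ∈ F := by
      refine ⟨U.add_mem huF.1 (U.smul_mem _ hv), fun i => ?_⟩
      rw [hgadd]
      by_cases hi : δ v i < 0
      · have h1 := hkmin i hi
        rw [le_div_iff₀ (by linarith)] at h1
        linarith
      · exact add_nonneg (huF.2 i) (mul_nonneg hc0 (not_lt.1 hi))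
    refine absurd (hmax _ hfeas) (not_le.2 (Finset.card_lt_card ?_))
    refine Finset.ssubset_iff_of_subset ?_ |>.2 ⟨k, by simpa using hgk, ?_⟩
    · intro i hi
      simp only [Finset.mem_filter, Finset.mem_univ, true_and] at hi ⊢
      rw [hgadd, hi]
      simp [hδ, hT i hi]
    · simp only [Finset.mem_filter, Finset.mem_univ, true_and]
      intro h
      simp [hδ, hT k h] at hk
  funext i
  have h1 := main v hv hT i
  have h2 := main (-v) (U.neg_mem hv) (fun i hi => by simp [hT i hi]) i
  simp only [hδ, Pi.neg_apply] at h1 h2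
  simp only [Pi.zero_apply]
  split_ifs at h1 h2 <;> linarith

theorem exists_reachable_columnValue_le {W : Matrix (Fin m) (Fin n) ℚ} {d : ℕ} (hd : W.rank ≤ d) :
    ∃ u, Reachable d W 0 u ∧ ∀ x y, columnValue W (negSupport u) ≤ pairValue W x y := by
  obtain ⟨y₀, hy⟩ := exists_columnValue_mulVec_le W
  obtain ⟨u, hu, hneg, hb⟩ := exists_basic_negSupport_eq (LinearMap.range W.mulVecLin)
    (u₀ := W *ᵥ fun j => bit (y₀ j)) ⟨_, rfl⟩
  obtain ⟨z, hz⟩ := hu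
  refine ⟨u, reachable_of_rank_le hb d W 0 hd le_rfl ⟨z, by rw [zero_add]; exact hz.symm⟩, ?_⟩
  rw [hneg]
  exact hy

theorem rank_add_le (A B : Matrix (Fin m) (Fin n) ℚ) : (A + B).rank ≤ A.rank + B.rank := by
  refine (Submodule.finrank_mono ?_).trans (Submodule.finrank_add_le_finrank_add_finrank _ _)
  rintro _ ⟨z, rfl⟩
  rw [mulVecLin_add]
  exact Submodule.add_mem_sup ⟨z, rfl⟩ ⟨z, rfl⟩

/-- The matrix is a column scaling of `A` by `-2` plus the all-ones matrix, which has rank at most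
one. -/
theorem rank_one_sub_double_le (A : Matrix (Fin m) (Fin n) ℚ) {r : ℕ} (hA : A.rank ≤ r) :
    (Matrix.of fun i j => 1 - (A i j + A i j) : Matrix (Fin m) (Fin n) ℚ).rank ≤ r + 1 := by
  have h : (Matrix.of fun i j => 1 - (A i j + A i j) : Matrix (Fin m) (Fin n) ℚ) =
      A * Matrix.diagonal (fun _ : Fin n => (-2 : ℚ)) + vecMulVec 1 1 := by
    ext i j
    simp
    ring
  rw [h]
  refine (rank_add_le _ _).trans (Nat.add_le_add ((rank_mul_le_left _ _).trans hA) ?_)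
  exact rank_vecMulVec_le _ _

end Elimination

end BooleanFactorization

/-! ### Scalar cells, single columns and bounds on the format -/

namespace RationalMachine

open BooleanFactorization

theorem Test.and_spec {L : ℕ} {s : State} {b c : Test} {P Q : Prop} [Decidable P] [Decidable Q]
    (hb : b.Fits L s ∧ b.eval s = decide P) (hc : c.Fits L s ∧ c.eval s = decide Q) :
    (Test.and b c).Fits L s ∧ (Test.and b c).eval s = decide (P ∧ Q) :=
  ⟨⟨hb.1, hc.1⟩, by simp [Test.eval, hb.2, hc.2]⟩

/-- The entry in row `i` and column `0` of the rational array `a`. -/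
def entry (a : ℕ) (i : NatExpr) : RatExpr := RatExpr.get a i (NatExpr.const 0)

/-- The scalar in cell `(0, 0)` of the rational array `a`. -/
def scalar (a : ℕ) : RatExpr := entry a (NatExpr.const 0)

/-- Assign the value of `e` to row `i` and column `0` of the rational array `a`. -/
def setEntry (a : ℕ) (i : NatExpr) (e : RatExpr) : Program :=
  Program.setRat a i (NatExpr.const 0) e

/-- The format is bounded by `K`, and its size by the size bound `L`. -/
structure FormatLe (L K m n : ℕ) : Prop where
  three_le : 3 ≤ L
  rowSize : Nat.size m ≤ L
  colSize : Nat.size n ≤ L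
  row : m ≤ K
  col : n ≤ K

theorem heightLe_bit (b : Bool) : HeightLe 0 (bit b) := by
  cases b
  · exact HeightLe.zero 0
  · exact HeightLe.one 0

theorem yields_entry {L B a i : ℕ} {s : State} {e : NatExpr} {q : ℚ} (he : e.Yields L s i)
    (hv : s.rat a i 0 = q) (hq : HeightLe B q) (hL : 2 * B + 3 ≤ L) :
    (entry a e).Yields L s B q :=
  RatExpr.Yields.get he (yields_zero L s) hv hq hL

theorem yields_scalar {L B a : ℕ} {s : State} {q : ℚ} (hv : s.rat a 0 0 = q) (hq : HeightLe B q)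
    (hL : 2 * B + 3 ≤ L) : (scalar a).Yields L s B q :=
  yields_entry (yields_zero L s) hv hq hL

theorem yields_const_zero {L : ℕ} (s : State) (hL : 3 ≤ L) :
    (RatExpr.const 0).Yields L s 0 0 := RatExpr.Yields.const (HeightLe.zero 0) hL

theorem yields_const_one {L : ℕ} (s : State) (hL : 3 ≤ L) :
    (RatExpr.const 1).Yields L s 0 1 := RatExpr.Yields.const (HeightLe.one 0) hL

theorem halts_setEntry {L B a k : ℕ} {i : NatExpr} {e : RatExpr} {s : State} {v : ℚ}
    {Q : State → Prop} (hi : i.Yields L s k) (he : e.Yields L s B v) (h : Q (s.setRat a k 0 v)) :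
    Halts L (setEntry a i e) s (i.cost + e.cost + 2) Q :=
  (Halts.setRat hi (yields_zero L s) he h).mono (by simp only [NatExpr.cost]; omega) fun _ h => h

theorem setRat_scalar (s : State) (a : ℕ) (q : ℚ) : (s.setRat a 0 0 q).rat a 0 0 = q := by
  simp [setRat_rat_self]

/-! ### Evaluation of a candidate -/

/-- Write the indicator vector of the negative entries of the column in array `a` into array `4`. -/
def setNegSupport (a : ℕ) : Program :=
  forLoop 4 0 (Program.ite (Test.ratLt (entry a (var 4)) (RatExpr.const 0))
    (setEntry 4 (var 4) (RatExpr.const 1)) (setEntry 4 (var 4) (RatExpr.const 0)))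

theorem halts_setNegSupport {L K m n a B : ℕ} (hF : FormatLe L K m n) {s : State}
    (hm : s.nat 0 0 = m) (ha : a ≠ 4) {h : Fin m → ℚ} (hs : ∀ i : Fin m, s.rat a i 0 = h i)
    (hB : ∀ i, HeightLe B (h i)) (hL : 2 * B + 3 ≤ L) :
    Halts L (setNegSupport a) s (K * 27 + 14)
      (fun s' => Frame {4} {4} s s' ∧ ∀ i : Fin m, s'.rat 4 i 0 = bit (negSupport h i)) := by
  have h3 := hF.three_le
  refine (halts_forLoop (T := 13) (K := K) (N := m)
    (fun k s' => Frame {4} {4} s s' ∧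
      ∀ i : Fin m, (i : ℕ) < k → s'.rat 4 i 0 = bit (negSupport h i))
    hF.rowSize (by omega) hF.row ?_ ?_ ?_ ?_).mono le_rfl ?_
  · intro k s' h; rw [h.1.1 0 (by simp), hm]
  · intro k s' v h; exact ⟨h.1.setNat rfl, h.2⟩
  · exact ⟨Frame.refl _ _ _, fun i hi => absurd hi (Nat.not_lt_zero _)⟩
  · intro k hk s' h4 ⟨hfr, hi⟩
    have y4 := yields_var h4 (size_mono_le hk.le hF.rowSize)
    have key : ∀ q : ℚ, q = bit (negSupport h ⟨k, hk⟩) →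
        (s'.setRat 4 k 0 q).nat 4 0 = k ∧ Frame {4} {4} s (s'.setRat 4 k 0 q) ∧
        ∀ i : Fin m, (i : ℕ) < k + 1 →
          (s'.setRat 4 k 0 q).rat 4 i 0 = bit (negSupport h i) := by
      intro q hq
      refine ⟨h4, hfr.setRat rfl, fun i hi' => ?_⟩
      rw [setRat_rat_self]
      split_ifs with hh
      · rw [hq]; congr 2; exact Fin.ext hh.1.symm
      · exact hi i (by omega)
    refine Halts.ite (T := 5) (Test.ratLt_spec (yields_entry (B := B) y4 ?_ (hB ⟨k, hk⟩) hL)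
      (yields_const_zero s' h3)) (fun hlt => ?_) (fun hlt => ?_)
    · rw [hfr.2 a (by simpa using ha)]; exact hs ⟨k, hk⟩
    · exact halts_setEntry y4 (yields_const_one s' h3) (key 1 (by simp [negSupport, bit, hlt]))
    · exact halts_setEntry y4 (yields_const_zero s' h3) (key 0 (by simp [negSupport, bit, hlt]))
  · intro s' h; exact ⟨h.1, fun i => h.2 i i.2⟩

/-- Write the sum of the entries in the rows selected by array `4` and in the column given by the
counter `5` of the matrix in array `8` into the scalar `6`. -/
def setColumnSum : Program :=
  Program.seq (setEntry 6 (NatExpr.const 0) (RatExpr.const 0))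
    (forLoop 4 0 (setEntry 6 (NatExpr.const 0) (RatExpr.add (scalar 6)
      (RatExpr.mul (entry 4 (var 4)) (RatExpr.get 8 (var 4) (var 5))))))

/-- The selected entries contribute products of height at most `B`, and each addition raises the
height by at most `B + 1`, so at most `K` summands give `K * (B + 1)`. -/
theorem halts_setColumnSum {L K m n B : ℕ} (hF : FormatLe L K m n) {s : State}
    (hm : s.nat 0 0 = m) {W : Matrix (Fin m) (Fin n) ℚ} (hW : s.matrix 8 m n = W)
    {x : Fin m → Bool} (hx : ∀ i : Fin m, s.rat 4 i 0 = bit (x i))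
    (hB : ∀ i j, HeightLe B (W i j)) (hL : 2 * (K * (B + 1)) + 3 ≤ L) (j : Fin n)
    (hj : s.nat 5 0 = j) :
    Halts L setColumnSum s (K * 33 + 18)
      (fun s' => Frame {4} {6} s s' ∧ s'.rat 6 0 0 = ∑ i, bit (x i) * W i j ∧
        HeightLe (K * (B + 1)) (s'.rat 6 0 0)) := by
  have h3 := hF.three_le
  have hWij : ∀ i : Fin m, s.rat 8 i j = W i j := fun i => by rw [← hW]; rfl
  refine (Halts.seq (T := 4) (T' := K * 33 + 14) (Q := fun s' => s' = s.setRat 6 0 0 0)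
    (halts_setEntry (yields_zero L s) (yields_const_zero s h3) rfl) ?_).mono (by omega)
    fun _ h => h
  rintro _ rfl
  refine (halts_forLoop (T := 19) (K := K) (N := m)
    (fun k s' => Frame {4} {6} s s' ∧
      s'.rat 6 0 0 = ∑ i ∈ Finset.range k, s.rat 4 i 0 * s.rat 8 i j ∧
      HeightLe (k * (B + 1)) (s'.rat 6 0 0))
    hF.rowSize (by omega) hF.row ?_ ?_ ?_ ?_).mono le_rfl ?_
  · intro k s' h; rw [h.1.1 0 (by simp), hm]
  · intro k s' v h; exact ⟨h.1.setNat rfl, h.2⟩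
  · refine ⟨(Frame.refl _ _ _).setRat rfl, ?_, ?_⟩
    · simp [setRat_scalar]
    · rw [setRat_scalar]; exact HeightLe.zero _
  · intro k hk s' h4 ⟨hfr, hsum, hht⟩
    have y4 := yields_var h4 (size_mono_le hk.le hF.rowSize)
    have y5 : (var 5).Yields L s' j := yields_var (by rw [hfr.1 5 (by simp), hj])
      (size_mono_le j.2.le hF.colSize)
    have hkK : (k + 1) * (B + 1) ≤ K * (B + 1) :=
      Nat.mul_le_mul_right _ (hk.trans_le hF.row)
    rw [Nat.succ_mul] at hkK
    have y1 := yields_scalar (a := 6) (s := s') (L := L) rfl hht (by omega)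
    have y2 := yields_entry (a := 4) y4 (q := s.rat 4 k 0) (by rw [hfr.2 4 (by simp)])
      (by rw [hx ⟨k, hk⟩]; exact heightLe_bit _) (by omega)
    have y3 := RatExpr.Yields.get (a := 8) y4 y5 (q := s.rat 8 k j) (by rw [hfr.2 8 (by simp)])
      (by rw [hWij ⟨k, hk⟩]; exact hB _ _) (by omega)
    have y := y1.add (y2.mul y3 (by omega)) (by omega)
    refine (halts_setEntry (yields_zero L s') y ⟨h4, hfr.setRat rfl, ?_, ?_⟩).mono
      (by simp [RatExpr.cost, NatExpr.cost, var, scalar, entry]) fun _ h => h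
    · rw [setRat_scalar, hsum, Finset.sum_range_succ]
    · rw [setRat_scalar]; exact y.2.2.mono (by rw [Nat.succ_mul]; omega)
  · intro s' ⟨hfr, hsum, hht⟩
    refine ⟨hfr, ?_, hht.mono (Nat.mul_le_mul_right _ hF.row)⟩
    rw [hsum, Finset.sum_range]
    exact Finset.sum_congr rfl fun i _ => by rw [hx, hWij]

/-- Write the best answer to the binary vector in array `4` into array `5` and its value into the
scalar `7`. -/
def setResponse : Program :=
  Program.seq (setEntry 7 (NatExpr.const 0) (RatExpr.const 0))
    (forLoop 5 1 (Program.seq setColumnSum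
      (Program.ite (Test.ratLt (scalar 6) (RatExpr.const 0))
        (Program.seq (setEntry 5 (var 5) (RatExpr.const 1))
          (setEntry 7 (NatExpr.const 0) (RatExpr.add (scalar 7) (scalar 6))))
        (setEntry 5 (var 5) (RatExpr.const 0)))))

theorem halts_setResponse {L K m n B : ℕ} (hF : FormatLe L K m n) {s : State}
    (hm : s.nat 0 0 = m) (hn : s.nat 1 0 = n) {W : Matrix (Fin m) (Fin n) ℚ}
    (hW : s.matrix 8 m n = W) {x : Fin m → Bool} (hx : ∀ i : Fin m, s.rat 4 i 0 = bit (x i))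
    (hB : ∀ i j, HeightLe B (W i j)) (hL : 2 * (K * (K * (B + 1) + 1)) + 3 ≤ L) :
    Halts L setResponse s (K * (K * 33 + 57) + 18)
      (fun s' => Frame {4, 5} {5, 6, 7} s s' ∧
        (∀ j : Fin n, s'.rat 5 j 0 = bit (negSupport (fun j => ∑ i, bit (x i) * W i j) j)) ∧
        s'.rat 7 0 0 = columnValue W x ∧
        HeightLe (K * (K * (B + 1) + 1)) (s'.rat 7 0 0)) := by
  have h3 := hF.three_le
  refine (Halts.seq (T := 4) (T' := K * ((K * 33 + 18) + 25 + 14) + 14)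
    (Q := fun s' => s' = s.setRat 7 0 0 0)
    (halts_setEntry (yields_zero L s) (yields_const_zero s h3) rfl) ?_).mono
    (le_of_eq (by ring)) fun _ h => h
  rintro _ rfl
  -- Column sums are indexed by natural numbers so that the invariant can sum over `Finset.range k`.
  set c : ℕ → ℚ := fun j => ∑ i, bit (x i) * s.rat 8 i j with hc
  have hcj : ∀ j : Fin n, c j = ∑ i, bit (x i) * W i j := fun j => by rw [← hW]; rfl
  refine (halts_forLoop (T := (K * 33 + 18) + 25) (K := K) (N := n)
    (fun k s' => Frame {4, 5} {5, 6, 7} s s' ∧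
      (∀ j : Fin n, (j : ℕ) < k → s'.rat 5 j 0 = bit (decide (c j < 0))) ∧
      s'.rat 7 0 0 = ∑ j ∈ Finset.range k, min 0 (c j) ∧
      HeightLe (k * (K * (B + 1) + 1)) (s'.rat 7 0 0))
    hF.colSize (by omega) hF.col ?_ ?_ ?_ ?_).mono le_rfl ?_
  · intro k s' h; rw [h.1.1 1 (by simp), hn]
  · intro k s' v h; exact ⟨h.1.setNat (by simp), h.2⟩
  · refine ⟨(Frame.refl _ _ _).setRat (by simp), fun i hi => absurd hi (Nat.not_lt_zero _), ?_, ?_⟩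
    · simp [setRat_scalar]
    · rw [setRat_scalar]; exact HeightLe.zero _
  · intro k hk s' h5 ⟨hfr, hy, hsum, hht⟩
    have hkK : (k + 1) * (K * (B + 1) + 1) ≤ K * (K * (B + 1) + 1) :=
      Nat.mul_le_mul_right _ (hk.trans_le hF.col)
    rw [Nat.succ_mul] at hkK
    refine Halts.seq (halts_setColumnSum hF (s := s') (W := W) (x := x) (B := B)
      (by rw [hfr.1 0 (by simp), hm])
      (by rw [← hW]; simp only [State.matrix]; rw [hfr.2 8 (by simp)])
      (fun i => by rw [hfr.2 4 (by simp), hx]) hB (by omega) ⟨k, hk⟩ h5) ?_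
    rintro s₁ ⟨hfr₁, hacc, hacch⟩
    have hacc' : s₁.rat 6 0 0 = c k := by rw [hacc]; exact (hcj ⟨k, hk⟩).symm
    have h5₁ : s₁.nat 5 0 = k := by rw [hfr₁.1 5 (by simp), h5]
    have y5 := yields_var h5₁ (size_mono_le hk.le hF.colSize)
    have hfr' : Frame {4, 5} {5, 6, 7} s s₁ := hfr.trans (hfr₁.mono (by simp) (by simp))
    have h7 : s₁.rat 7 = s'.rat 7 := hfr₁.2 7 (by simp)
    have h55 : s₁.rat 5 = s'.rat 5 := hfr₁.2 5 (by simp)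
    have key : ∀ q : ℚ, q = bit (decide (c k < 0)) → ∀ j : Fin n, (j : ℕ) < k + 1 →
        (s₁.setRat 5 k 0 q).rat 5 j 0 = bit (decide (c j < 0)) := by
      intro q hq j hj
      rw [setRat_rat_self]
      split_ifs with hh
      · rw [hq, hh.1]
      · rw [h55]; exact hy j (by omega)
    refine (Halts.ite (T := 5 + 11) (Test.ratLt_spec (yields_scalar hacc' (hacc' ▸ hacch)
      (by omega)) (yields_const_zero s₁ h3)) (fun hlt => ?_) (fun hlt => ?_)).mono
      (by simp [Test.cost, Test.ratLt, RatExpr.cost, NatExpr.cost, scalar, entry]) fun _ h => h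
    · refine Halts.seq (T := 5) (T' := 11) (halts_setEntry
        (Q := fun s₂ => s₂ = s₁.setRat 5 k 0 1) y5 (yields_const_one s₁ h3) rfl) ?_
      rintro _ rfl
      have y1 := yields_scalar (L := L) (a := 7) (s := s₁.setRat 5 k 0 1) (q := s'.rat 7 0 0)
        (by rw [setRat_rat_of_ne _ _ _ _ (by simp), h7]) hht (by omega)
      have y2 := yields_scalar (L := L) (a := 6) (s := s₁.setRat 5 k 0 1) (q := c k)
        (by rw [setRat_rat_of_ne _ _ _ _ (by simp), hacc']) (hacc' ▸ hacch) (by omega)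
      have y := y1.add y2 (by omega)
      refine (halts_setEntry (yields_zero L _) y ⟨h5₁, (hfr'.setRat (by simp)).setRat (by simp),
        fun j hj => ?_, ?_, ?_⟩).mono
        (by simp [RatExpr.cost, NatExpr.cost, scalar, entry]) fun _ h => h
      · rw [setRat_rat_of_ne _ _ _ _ (by simp)]
        exact key 1 (by simp [bit, hlt]) j hj
      · rw [setRat_scalar, hsum, Finset.sum_range_succ, min_eq_right hlt.le]
      · rw [setRat_scalar]; exact y.2.2.mono (by rw [Nat.succ_mul]; omega)
    · refine (halts_setEntry y5 (yields_const_zero s₁ h3) ⟨h5₁, hfr'.setRat (by simp),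
        key 0 (by simp [bit, hlt]), ?_, ?_⟩).mono
        (by simp [RatExpr.cost, NatExpr.cost, var]) fun _ h => h
      · rw [setRat_rat_of_ne _ _ _ _ (by simp), h7, hsum, Finset.sum_range_succ,
          min_eq_left (not_lt.1 hlt), add_zero]
      · rw [setRat_rat_of_ne _ _ _ _ (by simp), h7]
        exact hht.mono (Nat.mul_le_mul_right _ (Nat.le_succ k))
  · intro s' ⟨hfr, hy, hsum, hht⟩
    refine ⟨hfr, fun j => ?_, ?_, hht.mono (Nat.mul_le_mul_right _ hF.col)⟩
    · rw [hy j j.2, hcj]; rfl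
    · rw [hsum, Finset.sum_range]
      exact Finset.sum_congr rfl fun j _ => by rw [hcj]

/-! ### The incumbent solution -/

section Incumbent

variable {m n : ℕ} (W : Matrix (Fin m) (Fin n) ℚ) (V : ℕ)
  (P : (Fin m → Bool) → (Fin n → Bool) → Prop)

/-- The arrays `1` and `2` hold binary vectors with the property `P`, and the scalar `3` holds
their value, of height at most `V`. -/
def HoldsIncumbent (s : State) : Prop :=
  ∃ x y, (∀ i : Fin m, s.rat 1 i 0 = bit (x i)) ∧ (∀ j : Fin n, s.rat 2 j 0 = bit (y j)) ∧
    s.rat 3 0 0 = pairValue W x y ∧ HeightLe V (s.rat 3 0 0) ∧ P x y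

/-- The value `v` is at most the value of the candidate `u`, unless the latter is not negative. -/
def Covers (v : ℚ) (u : Fin m → ℚ) : Prop :=
  v ≤ columnValue W (negSupport u) ∨ 0 ≤ columnValue W (negSupport u)

variable {W V P}

theorem HoldsIncumbent.congr {s s' : State} (h : HoldsIncumbent W V P s)
    (h1 : s'.rat 1 = s.rat 1) (h2 : s'.rat 2 = s.rat 2) (h3 : s'.rat 3 = s.rat 3) :
    HoldsIncumbent W V P s' := by
  unfold HoldsIncumbent
  rw [h1, h2, h3]
  exact h

theorem Covers.mono {v v' : ℚ} {u : Fin m → ℚ} (h : Covers W v u) (hv : v' ≤ v) :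
    Covers W v' u :=
  h.imp hv.trans id

end Incumbent

/-- Replace the incumbent by the vectors in the arrays `4` and `5` if their value, which is the
scalar `7`, is negative and less than that of the incumbent. -/
def improve : Program :=
  Program.ite (Test.and (Test.ratLt (scalar 7) (scalar 3)) (Test.ratLt (scalar 7) (RatExpr.const 0)))
    (Program.seq (fillColumn 1 0 (NatExpr.const 0) (entry 4 (var 4)))
      (Program.seq (fillColumn 2 1 (NatExpr.const 0) (entry 5 (var 4)))
        (setEntry 3 (NatExpr.const 0) (scalar 7))))
    Program.skip

/-- Try the negative support of the column in array `a` as the first vector. -/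
def evaluate (a : ℕ) : Program :=
  Program.seq (setNegSupport a) (Program.seq setResponse improve)

/-- The response realizes `columnValue` for the negative support of `h`. Acceptance requires a
negative value below the incumbent, so `hP` preserves `P`; rejection means that one of the two
alternatives of `Covers` already holds. -/
theorem halts_evaluate {L K m n B B' V a : ℕ} (hF : FormatLe L K m n) {s : State} (ha : 8 ≤ a)
    (hm : s.nat 0 0 = m) (hn : s.nat 1 0 = n) {W : Matrix (Fin m) (Fin n) ℚ}
    (hW : s.matrix 8 m n = W) {P : (Fin m → Bool) → (Fin n → Bool) → Prop}
    (hP : ∀ x y, pairValue W x y < 0 → P x y) {h : Fin m → ℚ}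
    (hs : ∀ i : Fin m, s.rat a i 0 = h i) (hB : ∀ i j, HeightLe B (W i j))
    (hB' : ∀ i, HeightLe B' (h i)) (hV : K * (K * (B + 1) + 1) ≤ V) (hL : 2 * V + 3 ≤ L)
    (hL' : 2 * B' + 3 ≤ L) (hI : HoldsIncumbent W V P s) :
    Halts L (evaluate a) s (K * (K * 33 + 128) + 87)
      (fun s' => Frame {4, 5} {1, 2, 3, 4, 5, 6, 7} s s' ∧ HoldsIncumbent W V P s' ∧
        s'.rat 3 0 0 ≤ s.rat 3 0 0 ∧ Covers W (s'.rat 3 0 0) h) := by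
  have h3 := hF.three_le
  refine (Halts.seq (halts_setNegSupport hF hm (by omega) hs hB' hL') (Q' := fun s' =>
    Frame {4, 5} {1, 2, 3, 4, 5, 6, 7} s s' ∧ HoldsIncumbent W V P s' ∧
      s'.rat 3 0 0 ≤ s.rat 3 0 0 ∧ Covers W (s'.rat 3 0 0) h)
    (T' := (K * (K * 33 + 57) + 18) + ((K * 22 + 14) + ((K * 22 + 14) + 7) + 20)) ?_).mono
    (by nlinarith) fun _ h => h
  rintro s₁ ⟨hfr₁, hx₁⟩
  refine Halts.seq (halts_setResponse hF (s := s₁) (W := W) (B := B) (by rw [hfr₁.1 0 (by simp), hm])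
    (by rw [hfr₁.1 1 (by simp), hn])
    (by rw [← hW]; simp only [State.matrix]; rw [hfr₁.2 8 (by simp)]) hx₁ hB (by omega)) ?_
  rintro s₂ ⟨hfr₂, hy₂, hv₂, hvh⟩
  have hx₂ : ∀ i : Fin m, s₂.rat 4 i 0 = bit (negSupport h i) := fun i => by
    rw [hfr₂.2 4 (by simp), hx₁]
  have hfr : Frame {4, 5} {1, 2, 3, 4, 5, 6, 7} s s₂ :=
    (hfr₁.mono (by simp) (by simp)).trans
      (hfr₂.mono (by simp) (by intro a; simp; tauto))
  have e1 : s₂.rat 1 = s.rat 1 := by rw [hfr₂.2 1 (by simp), hfr₁.2 1 (by simp)]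
  have e2 : s₂.rat 2 = s.rat 2 := by rw [hfr₂.2 2 (by simp), hfr₁.2 2 (by simp)]
  have e3 : s₂.rat 3 = s.rat 3 := by rw [hfr₂.2 3 (by simp), hfr₁.2 3 (by simp)]
  have hI₂ : HoldsIncumbent W V P s₂ := hI.congr e1 e2 e3
  have hh3 : HeightLe V (s₂.rat 3 0 0) := by
    obtain ⟨_, _, -, -, -, hh, -⟩ := hI₂
    exact hh
  have hvh' : HeightLe V (s₂.rat 7 0 0) := hvh.mono hV
  have y7 := yields_scalar (L := L) rfl hvh' hL
  refine (Halts.ite (T := (K * 22 + 14) + ((K * 22 + 14) + 6)) (Test.and_spec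
    (Test.ratLt_spec y7 (yields_scalar (L := L) rfl hh3 hL))
    (Test.ratLt_spec y7 (yields_const_zero s₂ h3))) (fun hlt => ?_) (fun hlt => ?_)).mono
    (by simp [Test.cost, Test.ratLt, RatExpr.cost, NatExpr.cost, scalar, entry]; omega) fun _ h => h
  · refine Halts.seq ((halts_fillColumn (K := K) (v := 0) (B := 0) (fun i => bit (negSupport h i))
      hF.rowSize (by omega) hF.row (by rw [hfr.1 0 (by simp), hm]) (by simp)
      (fun s' _ => yields_zero L s') ?_).mono le_rfl fun _ h => h) ?_
    · intro i s' h' h4 _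
      refine yields_entry (yields_var h4 (size_mono_le i.2.le hF.rowSize)) ?_ (heightLe_bit _)
        (by omega)
      rw [h'.2 4 (by simp), hx₂]
    rintro s₃ ⟨hfr₃, hX₃, -⟩
    refine Halts.seq ((halts_fillColumn (K := K) (v := 0) (B := 0)
      (fun j => bit (negSupport (fun j => ∑ i, bit (negSupport h i) * W i j) j))
      hF.colSize (by omega) hF.col (by rw [hfr₃.1 1 (by simp), hfr.1 1 (by simp), hn]) (by simp)
      (fun s' _ => yields_zero L s') ?_).mono le_rfl fun _ h => h) ?_
    · intro i s' h' h4 _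
      refine yields_entry (yields_var h4 (size_mono_le i.2.le hF.colSize)) ?_ (heightLe_bit _)
        (by omega)
      rw [h'.2 5 (by simp), hfr₃.2 5 (by simp), hy₂]
    rintro s₄ ⟨hfr₄, hY₄, -⟩
    have e7 : s₄.rat 7 = s₂.rat 7 := by rw [hfr₄.2 7 (by simp), hfr₃.2 7 (by simp)]
    refine (halts_setEntry (yields_zero L s₄) (yields_scalar (B := V) rfl (e7 ▸ hvh') hL)
      ⟨?_, ?_, ?_, ?_⟩).mono (by simp [RatExpr.cost, NatExpr.cost, scalar, entry]) fun _ h => h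
    · exact ((hfr.trans (hfr₃.mono (by simp) (by simp))).trans
        (hfr₄.mono (by simp) (by simp))).setRat (by simp)
    · refine ⟨negSupport h, negSupport (fun j => ∑ i, bit (negSupport h i) * W i j), fun i => ?_,
        fun j => ?_, ?_, ?_, hP _ _ ?_⟩
      · rw [setRat_rat_of_ne _ _ _ _ (by simp), hfr₄.2 1 (by simp)]; exact hX₃ i
      · rw [setRat_rat_of_ne _ _ _ _ (by simp)]; exact hY₄ j
      · rw [setRat_scalar, e7, hv₂, pairValue_negSupport]
      · rw [setRat_scalar, e7]; exact hvh'
      · rw [pairValue_negSupport, ← hv₂]; exact hlt.2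
    · rw [setRat_scalar, e7, ← e3]; exact hlt.1.le
    · rw [setRat_scalar, e7, hv₂]; exact Or.inl le_rfl
  · refine (Halts.skip ⟨hfr, hI₂, (by rw [e3]), ?_⟩).mono (by omega) fun _ h => h
    unfold Covers
    rw [← hv₂]
    rcases not_and_or.1 hlt with h' | h'
    · exact Or.inl (not_lt.1 h')
    · exact Or.inr (not_lt.1 h')

end RationalMachine

namespace RationalMachine

open BooleanFactorization

/-! ### The search -/

/-- The entry of the matrix in array `8 + 2 * t` at the pivot given by the counters. -/
def pivotEntry (t : ℕ) : RatExpr := RatExpr.get (8 + 2 * t) (var (6 + 2 * t)) (var (7 + 2 * t))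

/-- The entry of the matrix in array `8 + 2 * t` in the pivot column. -/
def pivotColumnEntry (t : ℕ) : RatExpr := RatExpr.get (8 + 2 * t) (var 4) (var (7 + 2 * t))

/-- Eliminate with the pivot given by the counters `6 + 2 * t` and `7 + 2 * t`, set the pivot entry
of the column to `q`, and run `p`. -/
def descend (t : ℕ) (q : ℚ) (p : Program) : Program :=
  Program.seq
    (fillMatrix (10 + 2 * t) 0 1 (RatExpr.sub (RatExpr.get (8 + 2 * t) (var 4) (var 5))
      (RatExpr.div (RatExpr.mul (pivotColumnEntry t)
        (RatExpr.get (8 + 2 * t) (var (6 + 2 * t)) (var 5))) (pivotEntry t))))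
    (Program.seq
      (fillColumn (11 + 2 * t) 0 (NatExpr.const 0) (RatExpr.add (entry (9 + 2 * t) (var 4))
        (RatExpr.mul (RatExpr.div (pivotColumnEntry t) (pivotEntry t))
          (RatExpr.sub (RatExpr.const q) (entry (9 + 2 * t) (var (6 + 2 * t)))))))
      p)

/-- Evaluate all candidates that arise by at most `d` eliminations from the matrix in array
`8 + 2 * t` and the column in array `9 + 2 * t`. -/
def search : ℕ → ℕ → Program
  | 0, t => evaluate (9 + 2 * t)
  | d + 1, t => Program.seq (evaluate (9 + 2 * t))
      (forLoop (6 + 2 * t) 0 (forLoop (7 + 2 * t) 1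
        (Program.ite (Test.ratNeZero (pivotEntry t))
          (Program.seq (descend t 0 (search d (t + 1))) (descend t (-1) (search d (t + 1))))
          Program.skip)))

/-- A bound for the number of steps of `search`. -/
def searchTime : ℕ → ℕ → ℕ
  | 0, K => K * (K * 33 + 128) + 87
  | d + 1, K => K * (K * 33 + 128) + 87 +
      (K * (K * (17 + (K * (K * 42 + 69) + 28 + searchTime d K +
        (K * (K * 42 + 69) + 28 + searchTime d K)) + 14) + 14 + 14) + 14)

/-- The effect of `descend t` and of `search d (t + 1)`. -/
def SearchFrame (t : ℕ) : State → State → Prop :=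
  Frame {c | c = 4 ∨ c = 5 ∨ 8 + 2 * t ≤ c} {a | (1 ≤ a ∧ a ≤ 7) ∨ 10 + 2 * t ≤ a}

/-- The recursive call enters through `hp`, as a continuation run on the eliminated matrix and the
adjusted column. Both are written to the arrays of the next level, so the data of level `t` survive
for the remaining pivots. -/
theorem halts_descend {L K m n t d B V T : ℕ} (hF : FormatLe L K m n) {s : State} {p : Program}
    (hm : s.nat 0 0 = m) (hn : s.nat 1 0 = n) {W : Matrix (Fin m) (Fin n) ℚ}
    (hW : s.matrix 8 m n = W) {P : (Fin m → Bool) → (Fin n → Bool) → Prop}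
    {M : Matrix (Fin m) (Fin n) ℚ} {h : Fin m → ℚ} (hM : s.matrix (8 + 2 * t) m n = M)
    (hs : ∀ i : Fin m, s.rat (9 + 2 * t) i 0 = h i) (hMB : ∀ i j, HeightLe B (M i j))
    (hhB : ∀ i, HeightLe B (h i)) (hB2 : 2 ≤ B) (hL : 10 * B + 3 ≤ L)
    (hI : HoldsIncumbent W V P s) (i : Fin m) (j : Fin n) (hi : s.nat (6 + 2 * t) 0 = i)
    (hj : s.nat (7 + 2 * t) 0 = j) (hij : M i j ≠ 0) {q : ℚ} (hq : q = 0 ∨ q = -1)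
    (hp : ∀ s', s'.nat 0 0 = m → s'.nat 1 0 = n → s'.matrix 8 m n = W →
      s'.matrix (8 + 2 * (t + 1)) m n = eliminate M i j →
      (∀ a : Fin m, s'.rat (9 + 2 * (t + 1)) a 0 = adjust M h i j q a) →
      (∀ a b, HeightLe (5 * B) (eliminate M i j a b)) →
      (∀ a, HeightLe (5 * B) (adjust M h i j q a)) → HoldsIncumbent W V P s' →
      Halts L p s' T (fun s'' => SearchFrame t s' s'' ∧ HoldsIncumbent W V P s'' ∧
        s''.rat 3 0 0 ≤ s'.rat 3 0 0 ∧
        ∀ u, Reachable d (eliminate M i j) (adjust M h i j q) u → Covers W (s''.rat 3 0 0) u)) :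
    Halts L (descend t q p) s (K * (K * 42 + 69) + 28 + T)
      (fun s' => SearchFrame t s s' ∧ HoldsIncumbent W V P s' ∧ s'.rat 3 0 0 ≤ s.rat 3 0 0 ∧
        ∀ u, Reachable d (eliminate M i j) (adjust M h i j q) u →
          Covers W (s'.rat 3 0 0) u) := by
  have h3 := hF.three_le
  have hMe : ∀ (a : Fin m) (b : Fin n), s.rat (8 + 2 * t) a b = M a b := fun a b => by
    rw [← hM]; rfl
  -- The expressions give heights `4 * B + 1` here and `4 * B + 2` for the adjusted column; `2 ≤ B`
  -- absorbs the constants into `5 * B`.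
  have hH1 : ∀ a b, HeightLe (5 * B) (eliminate M i j a b) := fun a b =>
    ((hMB a b).sub (((hMB a j).mul (hMB i b)).div (hMB i j))).mono (by omega)
  have hqh : HeightLe 0 q := by
    rcases hq with rfl | rfl
    · exact HeightLe.zero 0
    · exact (HeightLe.one 0).neg
  have hH2 : ∀ a, HeightLe (5 * B) (adjust M h i j q a) := fun a =>
    ((hhB a).add (((hMB a j).div (hMB i j)).mul (hqh.sub (hhB i)))).mono (by omega)
  refine (Halts.seq (T := K * (K * (23 + 19) + 28) + 14) (T' := (K * 41 + 14) + T)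
    ((halts_fillMatrix (K := K) (B := B + (B + B + B) + 1) (eliminate M i j) hF.rowSize
    hF.colSize (by omega) hF.row hF.col hm hn (by omega) (by omega) ?_).mono (by simp [RatExpr.cost, NatExpr.cost, var, pivotEntry,
    pivotColumnEntry]) fun _ h => h)
    ?_).mono (le_of_eq (by ring)) fun _ h => h
  · intro a b s' hfr h4 h5 _
    have y4 := yields_var h4 (size_mono_le a.2.le hF.rowSize)
    have y5 := yields_var h5 (size_mono_le b.2.le hF.colSize)
    have yi : (var (6 + 2 * t)).Yields L s' i := yields_var
      (by rw [hfr.1 (6 + 2 * t) (by simp; omega), hi]) (size_mono_le i.2.le hF.rowSize)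
    have yj : (var (7 + 2 * t)).Yields L s' j := yields_var
      (by rw [hfr.1 (7 + 2 * t) (by simp; omega), hj]) (size_mono_le j.2.le hF.colSize)
    have hr : s'.rat (8 + 2 * t) = s.rat (8 + 2 * t) := hfr.2 _ (by simp)
    have hL' : 2 * B + 3 ≤ L := by omega
    exact (RatExpr.Yields.get y4 y5 (by rw [hr, hMe]) (hMB a b) hL').sub
      (((RatExpr.Yields.get y4 yj (by rw [hr, hMe]) (hMB a j) hL').mul
        (RatExpr.Yields.get yi y5 (by rw [hr, hMe]) (hMB i b) hL') (by omega)).div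
        (RatExpr.Yields.get yi yj (by rw [hr, hMe]) (hMB i j) hL') hij (by omega)) (by omega)
  rintro s₁ ⟨hfr₁, hM₁⟩
  refine Halts.seq (T := K * 41 + 14) ((halts_fillColumn (K := K) (v := 0)
    (B := B + (B + B + (0 + B + 1)) + 1) (adjust M h i j q)
    hF.rowSize (by omega) hF.row (by rw [hfr₁.1 0 (by simp), hm]) (by simp)
    (fun s' _ => yields_zero L s') ?_).mono (by simp [RatExpr.cost, NatExpr.cost, var, pivotEntry,
    pivotColumnEntry, entry]) fun _ h => h) ?_
  · intro a s' hfr h4 _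
    have y4 := yields_var h4 (size_mono_le a.2.le hF.rowSize)
    have yi : (var (6 + 2 * t)).Yields L s' i := yields_var
      (by rw [hfr.1 (6 + 2 * t) (by simp; omega), hfr₁.1 (6 + 2 * t) (by simp; omega), hi])
      (size_mono_le i.2.le hF.rowSize)
    have yj : (var (7 + 2 * t)).Yields L s' j := yields_var
      (by rw [hfr.1 (7 + 2 * t) (by simp; omega), hfr₁.1 (7 + 2 * t) (by simp; omega), hj])
      (size_mono_le j.2.le hF.colSize)
    have hr : s'.rat (8 + 2 * t) = s.rat (8 + 2 * t) :=
      (hfr.2 _ (by simp)).trans (hfr₁.2 _ (by simp))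
    have hr' : s'.rat (9 + 2 * t) = s.rat (9 + 2 * t) :=
      (hfr.2 _ (by simp)).trans (hfr₁.2 _ (by simp))
    have hL' : 2 * B + 3 ≤ L := by omega
    exact (yields_entry y4 (by rw [hr', hs]) (hhB a) hL').add
      (((RatExpr.Yields.get y4 yj (by rw [hr, hMe]) (hMB a j) hL').div
        (RatExpr.Yields.get yi yj (by rw [hr, hMe]) (hMB i j) hL') hij (by omega)).mul
        ((RatExpr.Yields.const hqh (by omega)).sub (yields_entry yi (by rw [hr', hs]) (hhB i) hL')
          (by omega)) (by omega)) (by omega)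
  rintro s₂ ⟨hfr₂, hh₂, -⟩
  have hrat : ∀ a, a < 10 + 2 * t → s₂.rat a = s.rat a := fun a ha =>
    (hfr₂.2 _ (by simp; omega)).trans (hfr₁.2 _ (by simp; omega))
  have hnat : ∀ c, c < 4 → s₂.nat c = s.nat c := fun c hc =>
    (hfr₂.1 _ (by simp; omega)).trans (hfr₁.1 _ (by simp; omega))
  have hfr : SearchFrame t s s₂ := by
    refine Frame.trans (s' := s₁) (hfr₁.mono ?_ ?_) (hfr₂.mono ?_ ?_) <;> intro c <;> simp <;>
      omega
  refine (hp s₂ (by rw [hnat 0 (by omega), hm]) (by rw [hnat 1 (by omega), hn]) ?_ ?_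
    (by rw [show 9 + 2 * (t + 1) = 11 + 2 * t by ring]; exact hh₂) hH1 hH2
    (hI.congr (hrat 1 (by omega)) (hrat 2 (by omega)) (hrat 3 (by omega)))).mono le_rfl ?_
  · rw [← hW]; simp only [State.matrix]; rw [hrat 8 (by omega)]
  · rw [← hM₁]; simp only [State.matrix]
    rw [show 8 + 2 * (t + 1) = 10 + 2 * t by ring, hfr₂.2 (10 + 2 * t) (by simp)]
  · rintro s₃ ⟨hf, hI', hle, hcov⟩
    exact ⟨hfr.trans hf, hI', by rw [← hrat 3 (by omega)]; exact hle, hcov⟩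

/-- Induction on the remaining depth `d`, for all levels `t`, mirrors the recursion of `Reachable`.
Array `8` keeps `W` itself at every level, since candidates are always valued by the original form.
Candidates that are not vertices are harmless: they are valued correctly like any others. -/
theorem halts_search {L K m n V B₀ : ℕ} (hF : FormatLe L K m n) {W : Matrix (Fin m) (Fin n) ℚ}
    {P : (Fin m → Bool) → (Fin n → Bool) → Prop} (hP : ∀ x y, pairValue W x y < 0 → P x y)
    (hWB : ∀ i j, HeightLe B₀ (W i j)) (hV : K * (K * (B₀ + 1) + 1) ≤ V) (hVL : 2 * V + 3 ≤ L)
    (d : ℕ) : ∀ (t B : ℕ) (M : Matrix (Fin m) (Fin n) ℚ) (h : Fin m → ℚ) (s : State),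
      s.nat 0 0 = m → s.nat 1 0 = n → s.matrix 8 m n = W → s.matrix (8 + 2 * t) m n = M →
      (∀ i : Fin m, s.rat (9 + 2 * t) i 0 = h i) → (∀ i j, HeightLe B (M i j)) →
      (∀ i, HeightLe B (h i)) → 2 ≤ B → 2 * (5 ^ d * B) + 3 ≤ L → HoldsIncumbent W V P s →
      Halts L (search d t) s (searchTime d K)
        (fun s' => Frame {c | c = 4 ∨ c = 5 ∨ 6 + 2 * t ≤ c}
            {a | (1 ≤ a ∧ a ≤ 7) ∨ 10 + 2 * t ≤ a} s s' ∧ HoldsIncumbent W V P s' ∧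
          s'.rat 3 0 0 ≤ s.rat 3 0 0 ∧ ∀ u, Reachable d M h u → Covers W (s'.rat 3 0 0) u) := by
  have h3 := hF.three_le
  induction d with
  | zero =>
    intro t B M h s hm hn hW hM hs hMB hhB hB2 hL hI
    refine (halts_evaluate hF (by omega) hm hn hW hP hs hWB hhB hV hVL (by omega) hI).mono
      le_rfl ?_
    rintro s' ⟨hfr, hI', hle, hcov⟩
    refine ⟨hfr.mono ?_ ?_, hI', hle, ?_⟩
    · intro c; simp; omega
    · intro c; simp; omega
    · rintro u rfl; exact hcov
  | succ d ih =>
    intro t B M h s hm hn hW hM hs hMB hhB hB2 hL hI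
    have hpow : 5 ^ (d + 1) * B = 5 ^ d * (5 * B) := by ring
    have hL10 : 10 * B + 3 ≤ L := by
      have : 5 * B ≤ 5 ^ d * (5 * B) := Nat.le_mul_of_pos_left _ (by positivity)
      omega
    set C : Set ℕ := {c | c = 4 ∨ c = 5 ∨ 6 + 2 * t ≤ c} with hC
    set R : Set ℕ := {a | (1 ≤ a ∧ a ≤ 7) ∨ 10 + 2 * t ≤ a} with hR
    -- Loop invariant: the column `h` itself and all candidates from pivots in `D` are covered. The
    -- set `D` grows in row-major order.
    let Good (D : Fin m → Fin n → Prop) (s' : State) : Prop :=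
      Frame C R s s' ∧ HoldsIncumbent W V P s' ∧ s'.rat 3 0 0 ≤ s.rat 3 0 0 ∧
        Covers W (s'.rat 3 0 0) h ∧ ∀ i j, D i j → M i j ≠ 0 → ∀ q, (q = 0 ∨ q = -1) →
          ∀ u, Reachable d (eliminate M i j) (adjust M h i j q) u → Covers W (s'.rat 3 0 0) u
    have hstay : ∀ {D : Fin m → Fin n → Prop} {s' : State} {c v : ℕ}, 6 + 2 * t ≤ c →
        Good D s' → Good D (s'.setNat c 0 v) := fun hc hG =>
      ⟨hG.1.setNat (by simp [hC, hc]), hG.2⟩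
    refine Halts.seq ((halts_evaluate (V := V) hF (by omega) hm hn hW hP hs hWB hhB hV hVL
      (by omega) hI).mono (Q' := Good fun _ _ => False) le_rfl ?_) ?_
    · rintro s' ⟨hfr, hI', hle, hcov⟩
      refine ⟨hfr.mono ?_ ?_, hI', hle, hcov, fun _ _ hf => hf.elim⟩
      · intro c; simp [hC]; omega
      · intro c; simp [hR]; omega
    intro s₀ hG₀
    refine (halts_forLoop (N := m) (fun k s' => Good (fun i _ => (i : ℕ) < k) s') hF.rowSize
      (by omega) hF.row ?_ ?_ ?_ ?_).mono le_rfl ?_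
    · intro k s' hG; rw [hG.1.1 0 (by simp [hC]), hm]
    · intro k s' v hG; exact hstay le_rfl hG
    · exact ⟨hG₀.1, hG₀.2.1, hG₀.2.2.1, hG₀.2.2.2.1, fun _ _ hf => absurd hf (Nat.not_lt_zero _)⟩
    · intro k hk s₁ hk₁ hG₁
      refine (halts_forLoop (N := n) (fun l s' => s'.nat (6 + 2 * t) 0 = k ∧
        Good (fun i j => (i : ℕ) < k ∨ ((i : ℕ) = k ∧ (j : ℕ) < l)) s') hF.colSize
        (by omega) hF.col ?_ ?_ ?_ ?_).mono le_rfl ?_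
      · intro l s' hG; rw [hG.2.1.1 1 (by simp [hC]; omega), hn]
      · intro l s' v hG
        exact ⟨by rw [setNat_nat_of_ne _ _ _ (by omega)]; exact hG.1, hstay (by omega) hG.2⟩
      · refine ⟨hk₁, hG₁.1, hG₁.2.1, hG₁.2.2.1, hG₁.2.2.2.1, fun i j hf => ?_⟩
        exact hG₁.2.2.2.2 i j (by omega)
      · rintro l hl s₂ hl₂ ⟨hk₂, hfr₂, hI₂, hle₂, hcov₂, hall₂⟩
        have e8 : ∀ {s' : State}, Frame C R s s' → s'.matrix (8 + 2 * t) m n = M := fun hf => by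
          rw [← hM]; simp only [State.matrix]; rw [hf.2 (8 + 2 * t) (by simp [hR]; omega)]
        have eW : ∀ {s' : State}, Frame C R s s' → s'.matrix 8 m n = W := fun hf => by
          rw [← hW]; simp only [State.matrix]; rw [hf.2 8 (by simp [hR]; omega)]
        have e9 : ∀ {s' : State}, Frame C R s s' → ∀ i : Fin m, s'.rat (9 + 2 * t) i 0 = h i :=
          fun hf i => by rw [hf.2 (9 + 2 * t) (by simp [hR]; omega), hs]
        have hsub : ∀ {s' s'' : State}, SearchFrame t s' s'' → Frame C R s' s'' := fun hf =>
          hf.mono (by intro c; simp [hC]; omega) (by intro c; simp [hR])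
        have y := RatExpr.Yields.get (L := L) (a := 8 + 2 * t)
          (yields_var hk₂ (size_mono_le hk.le hF.rowSize))
          (yields_var hl₂ (size_mono_le hl.le hF.colSize)) (q := M ⟨k, hk⟩ ⟨l, hl⟩)
          (by rw [← e8 hfr₂]; rfl) (hMB _ _) (by omega)
        have step : ∀ q : ℚ, (q = 0 ∨ q = -1) → M ⟨k, hk⟩ ⟨l, hl⟩ ≠ 0 → ∀ s' : State,
            Frame C R s s' → HoldsIncumbent W V P s' → s'.nat (6 + 2 * t) 0 = k →
            s'.nat (7 + 2 * t) 0 = l →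
            Halts L (descend t q (search d (t + 1))) s'
              (K * (K * 42 + 69) + 28 + searchTime d K)
              (fun s'' => SearchFrame t s' s'' ∧ HoldsIncumbent W V P s'' ∧
                s''.rat 3 0 0 ≤ s'.rat 3 0 0 ∧
                ∀ u, Reachable d (eliminate M ⟨k, hk⟩ ⟨l, hl⟩) (adjust M h ⟨k, hk⟩ ⟨l, hl⟩ q) u →
                  Covers W (s''.rat 3 0 0) u) := by
          intro q hq h0 s' hf hI' hk' hl'
          refine halts_descend hF (by rw [hf.1 0 (by simp [hC]), hm])
            (by rw [hf.1 1 (by simp [hC]; omega), hn]) (eW hf) (e8 hf) (e9 hf) hMB hhB hB2 hL10 hI'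
            ⟨k, hk⟩ ⟨l, hl⟩ hk' hl' h0 hq ?_
          intro s'' h1 h2 h3 h4 h5 h6 h7 h8
          refine (ih (t + 1) (5 * B) _ _ s'' h1 h2 h3 h4 h5 h6 h7 (by omega) (hpow ▸ hL) h8).mono
            le_rfl ?_
          rintro s₃ ⟨hf₃, hr₃⟩
          refine ⟨hf₃.mono ?_ ?_, hr₃⟩
          · intro c; simp; omega
          · intro c; simp; omega
        refine (Halts.ite (Test.ratNeZero_spec y h3)
          (T := K * (K * 42 + 69) + 28 + searchTime d K +
            (K * (K * 42 + 69) + 28 + searchTime d K))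
          (fun h0 => ?_) (fun h0 => ?_)).mono
          (by simp [Test.cost, Test.ratNeZero, RatExpr.cost, NatExpr.cost, var])
          fun _ h => h
        · refine Halts.seq (step 0 (Or.inl rfl) h0 s₂ hfr₂ hI₂ hk₂ hl₂) ?_
          rintro s₃ ⟨hf₃, hI₃, hle₃, hcov₃⟩
          have hk₃ : s₃.nat (6 + 2 * t) 0 = k := by
            rw [hf₃.1 _ (by simp; omega), hk₂]
          have hl₃ : s₃.nat (7 + 2 * t) 0 = l := by
            rw [hf₃.1 _ (by simp; omega), hl₂]
          refine (step (-1) (Or.inr rfl) h0 s₃ (hfr₂.trans (hsub hf₃)) hI₃ hk₃ hl₃).mono le_rfl ?_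
          rintro s₄ ⟨hf₄, hI₄, hle₄, hcov₄⟩
          refine ⟨by rw [hf₄.1 _ (by simp; omega), hl₃],
            by rw [hf₄.1 _ (by simp; omega), hk₃],
            (hfr₂.trans (hsub hf₃)).trans (hsub hf₄), hI₄, hle₄.trans (hle₃.trans hle₂),
            hcov₂.mono (hle₄.trans hle₃), ?_⟩
          intro i j hD hij q hq u hu
          -- The new pivot is covered by the two calls just made. For older pivots coverage persists
          -- because the incumbent value never increases.
          by_cases hnew : (i : ℕ) = k ∧ (j : ℕ) = l
          · obtain rfl : i = ⟨k, hk⟩ := Fin.ext hnew.1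
            obtain rfl : j = ⟨l, hl⟩ := Fin.ext hnew.2
            rcases hq with rfl | rfl
            · exact (hcov₃ u hu).mono hle₄
            · exact hcov₄ u hu
          · exact (hall₂ i j (by omega) hij q hq u hu).mono (hle₄.trans hle₃)
        · refine (Halts.skip ⟨hl₂, hk₂, hfr₂, hI₂, hle₂, hcov₂, ?_⟩).mono (by omega) fun _ h => h
          intro i j hD hij
          refine hall₂ i j ?_ hij
          have : ¬ ((i : ℕ) = k ∧ (j : ℕ) = l) := by
            rintro ⟨hik, hjl⟩
            obtain rfl : i = ⟨k, hk⟩ := Fin.ext hik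
            obtain rfl : j = ⟨l, hl⟩ := Fin.ext hjl
            exact h0 hij
          omega
      · rintro s' ⟨hk', hfr, hI', hle, hcov, hall⟩
        exact ⟨hk', hfr, hI', hle, hcov, fun i j hD => hall i j (by omega)⟩
    · rintro s' ⟨hfr, hI', hle, hcov, hall⟩
      refine ⟨hfr, hI', hle, ?_⟩
      rintro u (rfl | ⟨i, j, hij, q, hq, hu⟩)
      · exact hcov
      · exact hall i j i.2 hij q hq u hu

end RationalMachine

namespace RationalMachine

open BooleanFactorization

/-! ### Polynomial bounds -/

/-- The function `f` is given by a polynomial with natural coefficients. -/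
def IsPolynomial (f : ℕ → ℕ) : Prop := ∃ p : Polynomial ℕ, ∀ x, p.eval x = f x

namespace IsPolynomial

variable {f g : ℕ → ℕ}

theorem const (c : ℕ) : IsPolynomial fun _ => c := ⟨Polynomial.C c, fun _ => by simp⟩

theorem id : IsPolynomial fun x => x := ⟨Polynomial.X, fun _ => by simp⟩

theorem add (hf : IsPolynomial f) (hg : IsPolynomial g) : IsPolynomial fun x => f x + g x := by
  obtain ⟨p, hp⟩ := hf
  obtain ⟨q, hq⟩ := hg
  exact ⟨p + q, fun x => by rw [Polynomial.eval_add, hp, hq]⟩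

theorem mul (hf : IsPolynomial f) (hg : IsPolynomial g) : IsPolynomial fun x => f x * g x := by
  obtain ⟨p, hp⟩ := hf
  obtain ⟨q, hq⟩ := hg
  exact ⟨p * q, fun x => by rw [Polynomial.eval_mul, hp, hq]⟩

end IsPolynomial

theorem isPolynomial_searchTime (d : ℕ) : IsPolynomial (searchTime d) := by
  have h1 : IsPolynomial fun K => K * (K * 33 + 128) + 87 :=
    (IsPolynomial.id.mul ((IsPolynomial.id.mul (.const _)).add (.const _))).add (.const _)
  have h2 : IsPolynomial fun K => K * (K * 42 + 69) + 28 :=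
    (IsPolynomial.id.mul ((IsPolynomial.id.mul (.const _)).add (.const _))).add (.const _)
  induction d with
  | zero => exact h1
  | succ d ih =>
    have h3 := h2.add ih
    exact h1.add ((IsPolynomial.id.mul (((IsPolynomial.id.mul
      (((IsPolynomial.const 17).add (h3.add h3)).add (.const 14))).add
        (.const 14)).add (.const 14))).add (.const 14))

theorem solvable_of_isPolynomial {Instance : (m n : ℕ) → Matrix (Fin m) (Fin n) ℚ → Prop}
    {Solution : (m n : ℕ) → Matrix (Fin m) (Fin n) ℚ → State → Prop} (p : Program)
    {T S : ℕ → ℕ} (hT : IsPolynomial T) (hS : IsPolynomial S)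
    (h : ∀ (m n : ℕ) (A : Matrix (Fin m) (Fin n) ℚ), 0 < m → 0 < n → Instance m n A →
      Halts (S (inputSize A)) p (inputState A) (T (m * n)) (Solution m n A)) :
    SolvableInStronglyPolynomialTime Instance Solution := by
  obtain ⟨T', hT'⟩ := hT
  obtain ⟨S', hS'⟩ := hS
  refine ⟨p, T', S', fun m n A hm hn hA => ?_⟩
  obtain ⟨t, s, h1, h2, h3⟩ := h m n A hm hn hA
  exact ⟨t, s, by rw [hS']; exact h1, by rw [hT']; exact h2, h3⟩

/-! ### Bounds in terms of the encoding length of the input -/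

section Input

variable {m n : ℕ} (A : Matrix (Fin m) (Fin n) ℚ)

theorem ratSize_le_inputSize (i : Fin m) (j : Fin n) : ratSize (A i j) ≤ inputSize A := by
  have h1 := Finset.single_le_sum (f := fun j => ratSize (A i j)) (fun _ _ => Nat.zero_le _)
    (Finset.mem_univ j)
  have h2 := Finset.single_le_sum (f := fun i => ∑ j, ratSize (A i j)) (fun _ _ => Nat.zero_le _)
    (Finset.mem_univ i)
  exact (h1.trans h2).trans (Nat.le_add_left _ _)

theorem heightLe_inputSize (i : Fin m) (j : Fin n) : HeightLe (inputSize A) (A i j) :=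
  (HeightLe.of_ratSize _).mono (ratSize_le_inputSize A i j)

theorem mul_le_inputSize : m * n ≤ inputSize A := by
  have h : ∑ _i : Fin m, ∑ _j : Fin n, 1 ≤ ∑ i, ∑ j, ratSize (A i j) :=
    Finset.sum_le_sum fun i _ => Finset.sum_le_sum fun j _ => by unfold ratSize; omega
  simp only [Finset.sum_const, Finset.card_univ, Fintype.card_fin, smul_eq_mul, mul_one] at h
  unfold inputSize
  omega

theorem formatLe_mul {L : ℕ} (hm : 0 < m) (hn : 0 < n) (h3 : 3 ≤ L) (hL : inputSize A ≤ L) :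
    FormatLe L (m * n) m n where
  three_le := h3
  rowSize := le_trans (by unfold inputSize; omega) hL
  colSize := le_trans (by unfold inputSize; omega) hL
  row := Nat.le_mul_of_pos_right m hn
  col := Nat.le_mul_of_pos_left n hm

end Input

/-! ### The programs for the factorization problem -/

/-- Write the matrix with the entries `1 - 2 * a i j` into array `8`. -/
def setObjective : Program :=
  fillMatrix 8 0 1 (RatExpr.sub (RatExpr.const 1)
    (RatExpr.add (RatExpr.get 0 (var 4) (var 5)) (RatExpr.get 0 (var 4) (var 5))))

/-- The matrix of the bilinear objective. -/
def objective {m n : ℕ} (A : Matrix (Fin m) (Fin n) ℚ) : Matrix (Fin m) (Fin n) ℚ :=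
  Matrix.of fun i j => 1 - (A i j + A i j)

theorem heightLe_objective {m n : ℕ} (A : Matrix (Fin m) (Fin n) ℚ) (i : Fin m) (j : Fin n) :
    HeightLe (2 * inputSize A + 2) (objective A i j) :=
  ((HeightLe.one 0).sub ((heightLe_inputSize A i j).add (heightLe_inputSize A i j))).mono (by omega)

theorem halts_setObjective {L K m n : ℕ} (hF : FormatLe L K m n) (A : Matrix (Fin m) (Fin n) ℚ)
    (hL : 2 * (2 * inputSize A + 2) + 3 ≤ L) :
    Halts L setObjective (inputState A) (K * (K * 32 + 28) + 14)
      (fun s => Frame {4, 5} {8} (inputState A) s ∧ s.matrix 8 m n = objective A) := by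
  refine (halts_fillMatrix (K := K) (B := 0 + (inputSize A + inputSize A + 1) + 1) (objective A)
    hF.rowSize hF.colSize (by have := hF.three_le; omega) hF.row hF.col rfl rfl (by omega)
    (by omega) ?_).mono (by simp [RatExpr.cost, NatExpr.cost, var]) fun _ h => h
  intro i j s hfr h4 h5 _
  have y : (RatExpr.get 0 (var 4) (var 5)).Yields L s (inputSize A) (A i j) := by
    refine RatExpr.Yields.get (yields_var h4 (size_mono_le i.2.le hF.rowSize))
      (yields_var h5 (size_mono_le j.2.le hF.colSize)) ?_ (heightLe_inputSize A i j) (by omega)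
    rw [hfr.2 0 (by simp)]
    simp [inputState]
  exact (yields_const_one s hF.three_le).sub (y.add y (by omega)) (by omega)

/-- Make the least entry of the matrix in array `8` the incumbent. -/
def setLeastEntry : Program :=
  Program.seq
    (forLoop 6 0 (forLoop 7 1
      (Program.ite (Test.ratLt (RatExpr.get 8 (var 6) (var 7)) (RatExpr.get 8 (var 2) (var 3)))
        (Program.seq (Program.setNat 2 (NatExpr.const 0) (var 6))
          (Program.setNat 3 (NatExpr.const 0) (var 7)))
        Program.skip)))
    (Program.seq (setEntry 1 (var 2) (RatExpr.const 1))
      (Program.seq (setEntry 2 (var 3) (RatExpr.const 1))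
        (setEntry 3 (NatExpr.const 0) (RatExpr.get 8 (var 2) (var 3)))))

/-- The running minimum is remembered by its position. The unit vectors at that position select
exactly this entry, so they form a nonzero pair whose value is the least entry. -/
theorem halts_setLeastEntry {L K m n B : ℕ} (hF : FormatLe L K m n) {s : State} (hm0 : 0 < m)
    (hn0 : 0 < n) (hm : s.nat 0 0 = m) (hn : s.nat 1 0 = n) (h2 : s.nat 2 0 = 0)
    (h3 : s.nat 3 0 = 0) {W : Matrix (Fin m) (Fin n) ℚ} (hW : s.matrix 8 m n = W)
    (hx : ∀ i, s.rat 1 i 0 = 0) (hy : ∀ j, s.rat 2 j 0 = 0) (hB : ∀ i j, HeightLe B (W i j))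
    (hL : 2 * B + 3 ≤ L) :
    Halts L setLeastEntry s (K * (K * 35 + 28) + 32)
      (fun s' => Frame {2, 3, 6, 7} {1, 2, 3} s s' ∧ (∀ i j, s'.rat 3 0 0 ≤ W i j) ∧
        HoldsIncumbent W B (fun x y => (∃ i, x i = true) ∧ ∃ j, y j = true) s') := by
  have h3L := hF.three_le
  have hWe : ∀ (i : Fin m) (j : Fin n), s.rat 8 i j = W i j := fun i j => by rw [← hW]; rfl
  let Good (D : ℕ → ℕ → Prop) (s' : State) : Prop :=
    Frame {2, 3, 6, 7} ∅ s s' ∧ ∃ (i : Fin m) (j : Fin n), s'.nat 2 0 = i ∧ s'.nat 3 0 = j ∧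
      ∀ (a : Fin m) (b : Fin n), D a b → W i j ≤ W a b
  have hstay : ∀ (D : ℕ → ℕ → Prop) {s' : State} {c v : ℕ}, (c = 6 ∨ c = 7) →
      Good D s' → Good D (s'.setNat c 0 v) := by
    rintro D s' c v hc ⟨hfr, i, j, hi, hj, hall⟩
    refine ⟨hfr.setNat (by simp; omega), i, j, ?_, ?_, hall⟩
    · rw [setNat_nat_of_ne _ _ _ (by omega), hi]
    · rw [setNat_nat_of_ne _ _ _ (by omega), hj]
  refine (Halts.seq (T := K * ((K * (21 + 14) + 14) + 14) + 14)
    (T' := 5 + (5 + 8)) (Q := Good fun _ _ => True) ?_ ?_).mono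
    (le_of_eq (by ring)) fun _ h => h
  · refine (halts_forLoop (N := m) (T := K * (21 + 14) + 14) (fun k s' => Good (fun i _ => i < k) s')
      hF.rowSize (by omega) hF.row ?_ ?_ ?_ ?_).mono le_rfl ?_
    · intro k s' hG; rw [hG.1.1 0 (by simp), hm]
    · intro k s' v hG; exact hstay (fun i _ => i < k) (Or.inl rfl) hG
    -- The position cells initially hold zero, and `(0, 0)` is a valid position because the matrix
    -- is nonempty.
    · exact ⟨Frame.refl _ _ _, ⟨0, hm0⟩, ⟨0, hn0⟩, h2, h3, fun _ _ hf => absurd hf (Nat.not_lt_zero _)⟩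
    · intro k hk s₁ hk₁ hG₁
      refine (halts_forLoop (N := n) (T := 21) (fun l s' => s'.nat 6 0 = k ∧
        Good (fun i j => i < k ∨ (i = k ∧ j < l)) s') hF.colSize
        (by omega) hF.col ?_ ?_ ?_ ?_).mono le_rfl ?_
      · intro l s' hG; rw [hG.2.1.1 1 (by simp), hn]
      · intro l s' v hG
        exact ⟨by rw [setNat_nat_of_ne _ _ _ (by omega)]; exact hG.1,
          hstay (fun i j => i < k ∨ (i = k ∧ j < l)) (Or.inr rfl) hG.2⟩
      · obtain ⟨hfr, i, j, hi, hj, hall⟩ := hG₁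
        exact ⟨hk₁, hfr, i, j, hi, hj, fun a b hab => hall a b (by omega)⟩
      · rintro l hl s₂ hl₂ ⟨hk₂, hfr₂, i, j, hi, hj, hall⟩
        have y6 := yields_var hk₂ (size_mono_le hk.le hF.rowSize)
        have y7 := yields_var hl₂ (size_mono_le hl.le hF.colSize)
        have hr : s₂.rat 8 = s.rat 8 := hfr₂.2 8 (by simp)
        have y1 := RatExpr.Yields.get (L := L) (a := 8) y6 y7 (q := W ⟨k, hk⟩ ⟨l, hl⟩)
          (by rw [hr]; exact hWe ⟨k, hk⟩ ⟨l, hl⟩) (hB _ _) hL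
        have y2 := RatExpr.Yields.get (L := L) (a := 8)
          (yields_var hi (size_mono_le i.2.le hF.rowSize))
          (yields_var hj (size_mono_le j.2.le hF.colSize)) (q := W i j)
          (by rw [hr]; exact hWe i j) (hB _ _) hL
        have hnew : ∀ (a : Fin m) (b : Fin n),
            ((a : ℕ) < k ∨ ((a : ℕ) = k ∧ (b : ℕ) < l + 1)) →
            ((a : ℕ) < k ∨ ((a : ℕ) = k ∧ (b : ℕ) < l)) ∨ (a = ⟨k, hk⟩ ∧ b = ⟨l, hl⟩) := by
          intro a b hab
          simp only [Fin.ext_iff]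
          omega
        refine (Halts.ite (T := 8) (Test.ratLt_spec y1 y2) (fun hlt => ?_)
          (fun hlt => ?_)).mono
          (by simp [Test.cost, Test.ratLt, RatExpr.cost, NatExpr.cost, var]) fun _ h => h
        · refine Halts.seq (T := 4) (T' := 4) (Halts.setNat (Q := fun s' => s' = s₂.setNat 2 0 k)
            (yields_zero L _) y6 rfl) ?_
          rintro _ rfl
          refine Halts.setNat (yields_zero L _) (v := l) (yields_var
            (by rw [setNat_nat_of_ne _ _ _ (by omega), hl₂]) (size_mono_le hl.le hF.colSize)) ?_
          refine ⟨by simp [setNat_nat_of_ne, hl₂], by simp [setNat_nat_of_ne, hk₂],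
            (hfr₂.setNat (by simp)).setNat (by simp), ⟨k, hk⟩, ⟨l, hl⟩,
            by simp [setNat_nat_of_ne], by simp, ?_⟩
          intro a b hab
          rcases hnew a b hab with h | ⟨rfl, rfl⟩
          · exact hlt.le.trans (hall a b h)
          · exact le_rfl
        · refine (Halts.skip ⟨hl₂, hk₂, hfr₂, i, j, hi, hj, ?_⟩).mono (by omega) fun _ h => h
          intro a b hab
          rcases hnew a b hab with h | ⟨rfl, rfl⟩
          · exact hall a b h
          · exact not_lt.1 hlt
      · rintro s' ⟨hk', hfr, i, j, hi, hj, hall⟩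
        exact ⟨hk', hfr, i, j, hi, hj, fun a b hab => hall a b (by have := b.2; omega)⟩
    · rintro s' ⟨hfr, i, j, hi, hj, hall⟩
      exact ⟨hfr, i, j, hi, hj, fun a b _ => hall a b a.2⟩
  · rintro s₁ ⟨hfr, i, j, hi, hj, hall⟩
    have yi : ∀ s' : State, s'.nat = s₁.nat → (var 2).Yields L s' i := fun s' h =>
      yields_var (by rw [h, hi]) (size_mono_le i.2.le hF.rowSize)
    have yj : ∀ s' : State, s'.nat = s₁.nat → (var 3).Yields L s' j := fun s' h =>
      yields_var (by rw [h, hj]) (size_mono_le j.2.le hF.colSize)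
    refine Halts.seq (T := 5) (halts_setEntry (Q := fun s' => s' = s₁.setRat 1 i 0 1) (yi _ rfl)
      (yields_const_one _ h3L) rfl) ?_
    rintro _ rfl
    refine Halts.seq (T := 5) (T' := 8) (halts_setEntry
      (Q := fun s' => s' = (s₁.setRat 1 i 0 1).setRat 2 j 0 1) (yj _ rfl)
      (yields_const_one _ h3L) rfl) ?_
    rintro _ rfl
    refine (halts_setEntry (Q := fun s' =>
      s' = ((s₁.setRat 1 i 0 1).setRat 2 j 0 1).setRat 3 0 0 (W i j)) (yields_zero L _)
      (RatExpr.Yields.get (a := 8) (yi ((s₁.setRat 1 i 0 1).setRat 2 j 0 1) rfl) (yj _ rfl)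
        (q := W i j) ?_ (hB i j) hL) rfl).mono
      (by simp [RatExpr.cost, NatExpr.cost, var]) ?_
    · rw [setRat_rat_of_ne _ _ _ _ (by simp), setRat_rat_of_ne _ _ _ _ (by simp),
        hfr.2 8 (by simp), hWe]
    rintro _ rfl
    refine ⟨?_, ?_, fun a => decide (a = i), fun b => decide (b = j), fun a => ?_, fun b => ?_,
      ?_, ?_, ⟨i, by simp⟩, j, by simp⟩
    · exact (((hfr.mono subset_rfl (by simp)).setRat (by simp)).setRat (by simp)).setRat (by simp)
    · intro a b
      rw [setRat_scalar]
      exact hall a b trivial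
    · rw [setRat_rat_of_ne _ _ _ _ (by simp), setRat_rat_of_ne _ _ _ _ (by simp),
        setRat_rat_self, hfr.2 1 (by simp), hx, bit_eq_ite]
      simp [Fin.ext_iff]
    · rw [setRat_rat_of_ne _ _ _ _ (by simp), setRat_rat_self,
        setRat_rat_of_ne _ _ _ _ (by simp), hfr.2 2 (by simp), hy, bit_eq_ite]
      simp [Fin.ext_iff]
    · rw [setRat_scalar, pairValue_single]
    · rw [setRat_scalar]
      exact hB i j

/-- A bound for the height of the values of candidates, in terms of the size of the input. -/
def valueBound (X : ℕ) : ℕ := X * (X * (2 * X + 2 + 1) + 1) + (2 * X + 2)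

/-- A bound for the sizes that occur in the search, in terms of the size of the input. -/
def searchSize (d X : ℕ) : ℕ := 2 * valueBound X + 2 * (5 ^ d * (2 * X + 2)) + 3

theorem isPolynomial_searchSize (d : ℕ) : IsPolynomial (searchSize d) := by
  have h1 : IsPolynomial fun X => 2 * X + 2 :=
    ((IsPolynomial.const 2).mul IsPolynomial.id).add (.const 2)
  have h2 : IsPolynomial valueBound :=
    (IsPolynomial.id.mul ((IsPolynomial.id.mul (h1.add (.const 1))).add (.const 1))).add h1
  exact (((IsPolynomial.const 2).mul h2).add
    ((IsPolynomial.const 2).mul ((IsPolynomial.const _).mul h1))).add (.const 3)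

/-! ### Optimality of the result of the search -/

section

variable {m n : ℕ} (A : Matrix (Fin m) (Fin n) ℚ)

theorem le_searchSize (d : ℕ) : 2 * (2 * inputSize A + 2) + 3 ≤ searchSize d (inputSize A) := by
  have : 2 * inputSize A + 2 ≤ 5 ^ d * (2 * inputSize A + 2) :=
    Nat.le_mul_of_pos_left _ (by positivity)
  unfold searchSize
  omega

theorem formatLe_searchSize (hm : 0 < m) (hn : 0 < n) (d : ℕ) :
    FormatLe (searchSize d (inputSize A)) (m * n) m n := by
  have := le_searchSize A d
  exact formatLe_mul A hm hn (by omega) (by omega)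

/-- The search covers every reachable vector, in particular one whose value is a lower bound for all
pairs. The two cases of `Covers` then become: the incumbent is globally minimal, or no pair has a
negative value. -/
theorem halts_search_objective {r : ℕ} (hA : A.rank ≤ r) (hm0 : 0 < m) (hn0 : 0 < n)
    {P : (Fin m → Bool) → (Fin n → Bool) → Prop}
    (hP : ∀ x y, pairValue (objective A) x y < 0 → P x y) {s : State}
    (hm : s.nat 0 0 = m) (hn : s.nat 1 0 = n) (hW : s.matrix 8 m n = objective A)
    (h9 : ∀ i, s.rat 9 i 0 = 0)
    (hI : HoldsIncumbent (objective A) (valueBound (inputSize A)) P s) :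
    Halts (searchSize (r + 1) (inputSize A)) (search (r + 1) 0) s (searchTime (r + 1) (m * n))
      (fun s' => HoldsIncumbent (objective A) (valueBound (inputSize A)) P s' ∧
        s'.rat 3 0 0 ≤ s.rat 3 0 0 ∧ ((∀ x y, s'.rat 3 0 0 ≤ pairValue (objective A) x y) ∨
          ∀ x y, 0 ≤ pairValue (objective A) x y)) := by
  have hK := mul_le_inputSize A
  refine (halts_search (V := valueBound (inputSize A)) (formatLe_searchSize A hm0 hn0 (r + 1)) hP
    (heightLe_objective A) ?_ (by unfold searchSize; omega) (r + 1) 0 (2 * inputSize A + 2)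
    (objective A) 0 s hm hn hW hW (fun i => h9 i) (heightLe_objective A) (fun _ => HeightLe.zero _) (by omega)
    (by unfold searchSize; omega) hI).mono le_rfl ?_
  · exact (Nat.mul_le_mul hK (Nat.add_le_add_right (Nat.mul_le_mul_right _ hK) 1)).trans
      (Nat.le_add_right _ _)
  · rintro s' ⟨-, hI', hle, hcov⟩
    obtain ⟨u, hu, hmin⟩ := exists_reachable_columnValue_le (rank_one_sub_double_le A hA)
    exact ⟨hI', hle, (hcov u hu).imp (fun h x y => h.trans (hmin x y))
      fun h x y => h.trans (hmin x y)⟩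

theorem outputsBestApproximation_of_pairValue_le {R : Set ℕ} {s : State} {x : Fin m → Bool}
    {y : Fin n → Bool} (hR : ∀ k ∈ R, k ≤ 1) (hx : ∀ i : Fin m, s.rat 1 i 0 = bit (x i))
    (hy : ∀ j : Fin n, s.rat 2 j 0 = bit (y j))
    (hxy : booleanRank (booleanProduct (fun _ : Fin 1 => x) (fun _ : Fin 1 => y)) ∈ R)
    (h : ∀ x' y', booleanRank (booleanProduct (fun _ : Fin 1 => x') (fun _ : Fin 1 => y')) ∈ R →
      pairValue (objective A) x y ≤ pairValue (objective A) x' y') :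
    OutputsBestApproximation R m n A s := by
  refine ⟨x, y, hx, hy, hxy, fun B' hB' => ?_⟩
  obtain ⟨x', y', rfl⟩ := exists_eq_booleanProduct_of_rank_le_one (hR _ hB')
  rw [squaredError_booleanProduct, squaredError_booleanProduct]
  exact (add_le_add_iff_left _).2 (h x' y' hB')

end

/-- The untouched arrays `1`, `2`, `3` already encode the zero pair with value `0`, which is optimal
when no value is negative. -/
theorem solvable_rank_le_one (r : ℕ) :
    SolvableInStronglyPolynomialTime (fun _ _ A => A.rank ≤ r)
      (OutputsBestApproximation {k | k ≤ 1}) := by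
  refine solvable_of_isPolynomial (Program.seq setObjective (search (r + 1) 0))
    (T := fun K => (K * (K * 32 + 28) + 14) + searchTime (r + 1) K)
    (((IsPolynomial.id.mul ((IsPolynomial.id.mul (.const _)).add (.const _))).add (.const _)).add
      (isPolynomial_searchTime _)) (isPolynomial_searchSize (r + 1)) ?_
  intro m n A hm0 hn0 hA
  have hF := formatLe_searchSize A hm0 hn0 (r + 1)
  refine Halts.seq (halts_setObjective hF A (le_searchSize A _)) ?_
  rintro s ⟨hfr, hW⟩
  have hrat : ∀ a, a ≠ 0 → a ≠ 8 → ∀ i j, s.rat a i j = 0 := fun a h0 h8 i j => by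
    rw [hfr.2 a (by simpa using h8)]
    simp [inputState, h0]
  have h3 := hrat 3 (by simp) (by simp) 0 0
  refine (halts_search_objective A hA hm0 hn0 (P := fun _ _ => True) (fun _ _ _ => trivial)
    (by rw [hfr.1 0 (by simp)]; rfl) (by rw [hfr.1 1 (by simp)]; rfl) hW
    (fun i => hrat 9 (by simp) (by simp) i 0) ⟨fun _ => false, fun _ => false,
      fun i => by rw [hrat 1 (by simp) (by simp)]; rfl,
      fun i => by rw [hrat 2 (by simp) (by simp)]; rfl, ?_, ?_, trivial⟩).mono le_rfl ?_
  · rw [h3]; simp [pairValue, bit]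
  · rw [h3]; exact HeightLe.zero _
  · rintro s' ⟨⟨x, y, hx, hy, hv, -, -⟩, hle, hopt⟩
    refine outputsBestApproximation_of_pairValue_le A (fun _ h => h) hx hy
      (booleanRank_booleanProduct_le x y) fun x' y' _ => ?_
    rw [← hv]
    rcases hopt with h | h
    · exact h x' y'
    · exact (hle.trans h3.le).trans (h x' y')

theorem solvable_rank_eq_one (r : ℕ) :
    SolvableInStronglyPolynomialTime (fun _ _ A => A.rank ≤ r)
      (OutputsBestApproximation {k | k = 1}) := by
  refine solvable_of_isPolynomial
    (Program.seq setObjective (Program.seq setLeastEntry (search (r + 1) 0)))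
    (T := fun K => (K * (K * 32 + 28) + 14) + ((K * (K * 35 + 28) + 32) + searchTime (r + 1) K))
    (((IsPolynomial.id.mul ((IsPolynomial.id.mul (.const _)).add (.const _))).add (.const _)).add
      (((IsPolynomial.id.mul ((IsPolynomial.id.mul (.const _)).add (.const _))).add (.const _)).add
      (isPolynomial_searchTime _))) (isPolynomial_searchSize (r + 1)) ?_
  intro m n A hm0 hn0 hA
  have hF := formatLe_searchSize A hm0 hn0 (r + 1)
  have hLS := le_searchSize A (r + 1)
  refine Halts.seq (halts_setObjective hF A hLS) ?_
  rintro s ⟨hfr, hW⟩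
  have hrat : ∀ a, a ≠ 0 → a ≠ 8 → ∀ i j, s.rat a i j = 0 := fun a h0 h8 i j => by
    rw [hfr.2 a (by simpa using h8)]
    simp [inputState, h0]
  have hm : s.nat 0 0 = m := by rw [hfr.1 0 (by simp)]; rfl
  have hn : s.nat 1 0 = n := by rw [hfr.1 1 (by simp)]; rfl
  refine Halts.seq (halts_setLeastEntry hF hm0 hn0 hm hn (by rw [hfr.1 2 (by simp)]; rfl)
    (by rw [hfr.1 3 (by simp)]; rfl) hW (fun i => hrat 1 (by simp) (by simp) i 0)
    (fun i => hrat 2 (by simp) (by simp) i 0) (heightLe_objective A) hLS) ?_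
  rintro s₁ ⟨hfr₁, hmin, x₁, y₁, hx₁, hy₁, hv₁, hh₁, hP₁⟩
  refine (halts_search_objective A hA hm0 hn0
    (P := fun x y => (∃ i, x i = true) ∧ ∃ j, y j = true)
    (fun _ _ => exists_true_of_pairValue_neg) (by rw [hfr₁.1 0 (by simp), hm])
    (by rw [hfr₁.1 1 (by simp), hn])
    (by rw [← hW]; simp only [State.matrix]; rw [hfr₁.2 8 (by simp)])
    (fun i => by rw [hfr₁.2 9 (by simp)]; exact hrat 9 (by simp) (by simp) i 0)
    -- The second summand of `valueBound` is there for the height of this initial entry.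
    ⟨x₁, y₁, hx₁, hy₁, hv₁, hh₁.mono (Nat.le_add_left _ _), hP₁⟩).mono le_rfl ?_
  rintro s' ⟨⟨x, y, hx, hy, hv, -, hP⟩, hle, hopt⟩
  refine outputsBestApproximation_of_pairValue_le A (fun _ h => le_of_eq h) hx hy
    ((booleanRank_booleanProduct_eq_one_iff x y).2 hP) fun x' y' hxy' => ?_
  rw [← hv]
  rcases hopt with h | h
  · exact h x' y'
  -- No pair has a negative value, so unit vectors show that all entries of the objective are
  -- nonnegative. The incumbent is at most the least entry, hence at most the value of any nonzero
  -- pair.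
  · obtain ⟨⟨i, hi⟩, j, hj⟩ := (booleanRank_booleanProduct_eq_one_iff x' y').1 hxy'
    exact (hle.trans (hmin i j)).trans (entry_le_pairValue
      (fun i j => by rw [← pairValue_single (objective A) i j]; exact h _ _) hi hj)

end RationalMachine

namespace BooleanFactorization

open Matrix RationalMachine

/-! ### Sizes of minors -/

section Minors

/-- Expanding the product of the row sums gives one term per function on the index set; the Leibniz
formula uses only the terms of permutations. -/
theorem natAbs_det_le {ι : Type} [Fintype ι] [DecidableEq ι] (M : Matrix ι ι ℤ) :
    M.det.natAbs ≤ ∏ i, ∑ j, (M i j).natAbs := by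
  rw [← det_transpose, det_apply, Finset.prod_univ_sum]
  refine (Int.natAbs_sum_le _ _).trans ?_
  calc ∑ σ : Equiv.Perm ι, (Equiv.Perm.sign σ • ∏ i, Mᵀ (σ i) i).natAbs
      = ∑ σ : Equiv.Perm ι, ∏ i, (M i (σ i)).natAbs := by
        refine Finset.sum_congr rfl fun σ _ => ?_
        rw [Units.smul_def, smul_eq_mul, Int.natAbs_mul, Int.units_natAbs, one_mul]
        exact map_prod Int.natAbsHom _ _
    _ = ∑ f ∈ Finset.univ.map ⟨fun σ : Equiv.Perm ι => (σ : ι → ι), DFunLike.coe_injective⟩,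
          ∏ i, (M i (f i)).natAbs := by rw [Finset.sum_map]; rfl
    _ ≤ _ := Finset.sum_le_sum_of_subset fun f _ => by simp

/-- Replacing row sums by products turns the determinant bound into a product over entries, so that
bit lengths simply add up. -/
theorem sum_le_prod_one_add {ι : Type} [DecidableEq ι] (s : Finset ι) (x : ι → ℕ) :
    ∑ i ∈ s, x i ≤ ∏ i ∈ s, (1 + x i) := by
  induction s using Finset.induction_on with
  | empty => simp
  | insert a s ha ih =>
    rw [Finset.sum_insert ha, Finset.prod_insert ha, add_mul, one_mul]
    have h1 : 1 ≤ ∏ i ∈ s, (1 + x i) := Finset.one_le_prod' fun i _ => by omega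
    have h2 := Nat.le_mul_of_pos_right (x a) h1
    omega

theorem prod_comp_le_prod {ι κ : Type} [Fintype ι] [Fintype κ] {I : ι → κ}
    (hI : Function.Injective I) {g : κ → ℕ} (hg : ∀ a, 1 ≤ g a) :
    ∏ l, g (I l) ≤ ∏ a, g a := by
  have h : ∏ l, g (I l) = ∏ a ∈ Finset.univ.map ⟨I, hI⟩, g a := by rw [Finset.prod_map]; rfl
  rw [h]
  exact Finset.prod_le_prod_of_subset_of_one_le' (Finset.subset_univ _) fun a _ _ => hg a

variable {m n : ℕ} (A : Matrix (Fin m) (Fin n) ℚ)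

/-- Every minor of a matrix has polynomial encoding length. -/
theorem heightLe_det_submatrix {ι : Type} [Fintype ι] [DecidableEq ι] (I : ι → Fin m)
    (J : ι → Fin n) : HeightLe (inputSize A) (A.submatrix I J).det := by
  by_cases hI : Function.Injective I
  swap
  · obtain ⟨a, b, hab, hne⟩ := Function.not_injective_iff.1 hI
    rw [det_zero_of_row_eq hne (by funext j; simp [hab])]
    exact HeightLe.zero _
  by_cases hJ : Function.Injective J
  swap
  · obtain ⟨a, b, hab, hne⟩ := Function.not_injective_iff.1 hJ
    rw [det_zero_of_column_eq hne (by intro i; simp [hab])]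
    exact HeightLe.zero _
  -- Row `a` is cleared of denominators by their product `R a`, giving the integer matrix `Z`. Both
  -- `R a` and the absolute row sum of `Z` are at most `G a`, and the product of all `G a` is at
  -- most `2 ^ inputSize A`.
  let R : Fin m → ℕ := fun a => ∏ b, (A a b).den
  have hR : ∀ a, 1 ≤ R a := fun a => Finset.one_le_prod' fun b _ => (A a b).den_pos
  let Z : Matrix (Fin m) (Fin n) ℤ := Matrix.of fun a b => (A a b).num * (R a / (A a b).den : ℕ)
  let G : Fin m → ℕ := fun a => ∏ b, 2 ^ ratSize (A a b)
  have hG : ∀ a, 1 ≤ G a := fun a => Finset.one_le_prod' fun b _ => Nat.one_le_two_pow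
  have hGX : ∏ a, G a ≤ 2 ^ inputSize A := by
    have : ∏ a, G a = 2 ^ ∑ a, ∑ b, ratSize (A a b) := by
      simp only [G, Finset.prod_pow_eq_pow_sum]
    rw [this]
    exact Nat.pow_le_pow_right two_pos (Nat.le_add_left _ _)
  have hZ : ∀ a b, (Z a b : ℚ) = R a * A a b := by
    intro a b
    have hd : (A a b).den ∣ R a := Finset.dvd_prod_of_mem (fun b => (A a b).den) (Finset.mem_univ b)
    have h0 : ((A a b).den : ℚ) ≠ 0 := by exact_mod_cast (A a b).den_ne_zero
    simp only [Z, of_apply, Int.cast_mul, Int.cast_natCast]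
    rw [Nat.cast_div hd h0]
    conv_rhs => rw [← Rat.num_div_den (A a b)]
    ring
  have hRG : ∀ a, R a ≤ G a := fun a => Finset.prod_le_prod' fun b _ =>
    (HeightLe.of_ratSize (A a b)).1
  have hZG : ∀ a, ∑ b, (Z a b).natAbs ≤ G a := by
    intro a
    calc ∑ b, (Z a b).natAbs ≤ ∑ b, (A a b).num.natAbs * R a := by
          refine Finset.sum_le_sum fun b _ => ?_
          simp only [Z, of_apply, Int.natAbs_mul, Int.natAbs_natCast]
          exact Nat.mul_le_mul_left _ (Nat.div_le_self _ _)
      _ = R a * ∑ b, (A a b).num.natAbs := by rw [← Finset.sum_mul, mul_comm]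
      _ ≤ (∏ b, (A a b).den) * ∏ b, (1 + (A a b).num.natAbs) :=
          Nat.mul_le_mul_left _ (sum_le_prod_one_add _ _)
      _ = ∏ b, (A a b).den * (1 + (A a b).num.natAbs) := Finset.prod_mul_distrib.symm
      _ ≤ G a := by
          refine Finset.prod_le_prod' fun b _ => ?_
          have h1 := (Nat.lt_size_self (A a b).den).le
          have h2 := Nat.lt_size_self (A a b).num.natAbs
          calc (A a b).den * (1 + (A a b).num.natAbs)
              ≤ 2 ^ Nat.size (A a b).den * 2 ^ Nat.size (A a b).num.natAbs :=
                Nat.mul_le_mul h1 (by omega)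
            _ = 2 ^ (Nat.size (A a b).den + Nat.size (A a b).num.natAbs) := (pow_add _ _ _).symm
            _ ≤ _ := Nat.pow_le_pow_right two_pos (by unfold ratSize; omega)
  refine HeightLe.of_eq_div (a := (Z.submatrix I J).det) (b := ((∏ l, R (I l) : ℕ) : ℤ)) ?_ ?_ ?_ ?_
  · exact_mod_cast (Nat.one_le_iff_ne_zero.1 (Finset.one_le_prod' fun l _ => hR (I l)))
  · have h0 : ((∏ l, R (I l) : ℕ) : ℚ) ≠ 0 := by
      exact_mod_cast (Nat.one_le_iff_ne_zero.1 (Finset.one_le_prod' fun l _ => hR (I l)))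
    rw [Int.cast_natCast, eq_div_iff h0, mul_comm, Int.cast_det, Nat.cast_prod, ← det_mul_column]
    congr 1
    ext i j
    exact (hZ _ _).symm
  · refine (natAbs_det_le _).trans (le_trans ?_ ((prod_comp_le_prod hI hG).trans hGX))
    refine Finset.prod_le_prod' fun l _ => le_trans ?_ (hZG (I l))
    have h : ∑ j, (Z.submatrix I J l j).natAbs =
        ∑ b ∈ Finset.univ.map ⟨J, hJ⟩, (Z (I l) b).natAbs := by rw [Finset.sum_map]; rfl
    rw [h]
    exact Finset.sum_le_sum_of_subset (Finset.subset_univ _)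
  · rw [Int.natAbs_natCast]
    exact (prod_comp_le_prod hI hR).trans ((Finset.prod_le_prod' fun a _ => hRG a).trans hGX)

/-- The matrix `M` is a Schur complement of a nonsingular square submatrix of `A`. -/
def IsSchurComplement (M : Matrix (Fin m) (Fin n) ℚ) : Prop :=
  ∃ (ι : Type) (_ : Fintype ι) (_ : DecidableEq ι) (I : ι → Fin m) (J : ι → Fin n)
    (N : Matrix (Fin m) ι ℚ), (A.submatrix I J).det ≠ 0 ∧
      (∀ a b, M a b = A a b - ∑ l, N a l * A (I l) b) ∧ ∀ a l, M a (J l) = 0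

variable {A}

/-- Subtracting from the bordering row `i` the combination `N i` of the rows `I` clears it on the
columns `J` and leaves `M i j` in the corner. This row operation is unipotent, and the result is
block triangular. -/
theorem det_submatrix_sumElim {ι : Type} [Fintype ι] [DecidableEq ι] {I : ι → Fin m}
    {J : ι → Fin n} {N : Matrix (Fin m) ι ℚ} {M : Matrix (Fin m) (Fin n) ℚ}
    (hM : ∀ a b, M a b = A a b - ∑ l, N a l * A (I l) b) (hJ : ∀ a l, M a (J l) = 0)
    (i : Fin m) (j : Fin n) :
    (A.submatrix (Sum.elim I fun _ : Unit => i) (Sum.elim J fun _ : Unit => j)).det =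
      (A.submatrix I J).det * M i j := by
  have h : (fromBlocks (1 : Matrix ι ι ℚ) 0 (Matrix.of fun (_ : Unit) l => -N i l) 1) *
      A.submatrix (Sum.elim I fun _ : Unit => i) (Sum.elim J fun _ : Unit => j) =
      fromBlocks (A.submatrix I J) (Matrix.of fun l (_ : Unit) => A (I l) j) 0
        (Matrix.of fun (_ : Unit) (_ : Unit) => M i j) := by
    have hs : A.submatrix (Sum.elim I fun _ : Unit => i) (Sum.elim J fun _ : Unit => j) =
        fromBlocks (A.submatrix I J) (Matrix.of fun l (_ : Unit) => A (I l) j)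
          (Matrix.of fun (_ : Unit) l => A i (J l)) (Matrix.of fun (_ : Unit) (_ : Unit) => A i j) := by
      ext (a | a) (b | b) <;> rfl
    rw [hs, fromBlocks_multiply]
    congr 1
    · simp
    · simp
    · ext a b
      have := hM i (J b)
      rw [hJ] at this
      simp [mul_apply] at this ⊢
      linarith
    · ext a b
      simp [mul_apply, hM i j]
      ring
  have h' := congrArg det h
  rw [det_mul, det_fromBlocks_zero₁₂, det_fromBlocks_zero₂₁] at h'
  simpa using h'

theorem IsSchurComplement.self : IsSchurComplement A A :=
  ⟨Empty, inferInstance, inferInstance, Empty.elim, Empty.elim, 0, by simp, by simp,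
    fun _ l => l.elim⟩

/-- The pivot row and column join the submatrix; by the bordering formula its determinant is
multiplied by the nonzero pivot. -/
theorem IsSchurComplement.eliminate {M : Matrix (Fin m) (Fin n) ℚ} (h : IsSchurComplement A M)
    {i : Fin m} {j : Fin n} (hij : M i j ≠ 0) : IsSchurComplement A (eliminate M i j) := by
  obtain ⟨ι, _, _, I, J, N, hdet, hM, hJ⟩ := h
  refine ⟨ι ⊕ Unit, inferInstance, inferInstance, Sum.elim I fun _ => i, Sum.elim J fun _ => j,
    Matrix.of fun a => Sum.elim (fun l => N a l - M a j / M i j * N i l) fun _ => M a j / M i j,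
    ?_, ?_, ?_⟩
  · rw [det_submatrix_sumElim hM hJ]
    exact mul_ne_zero hdet hij
  · intro a b
    have h1 : ∑ l, (N a l - M a j / M i j * N i l) * A (I l) b =
        ∑ l, N a l * A (I l) b - M a j / M i j * ∑ l, N i l * A (I l) b := by
      rw [Finset.mul_sum, ← Finset.sum_sub_distrib]
      exact Finset.sum_congr rfl fun l _ => by ring
    simp only [BooleanFactorization.eliminate, of_apply, Fintype.sum_sum_type, Sum.elim_inl,
      Sum.elim_inr, Finset.univ_unique, Finset.sum_singleton, h1]
    have h2 := hM a b
    have h3 := hM i b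
    rw [h2, mul_div_right_comm, h3]
    ring
  · rintro a (l | l)
    · simp [BooleanFactorization.eliminate, hJ]
    · simp [BooleanFactorization.eliminate, hij]

theorem IsSchurComplement.heightLe {M : Matrix (Fin m) (Fin n) ℚ} (h : IsSchurComplement A M)
    (i : Fin m) (j : Fin n) : HeightLe (inputSize A + inputSize A) (M i j) := by
  obtain ⟨ι, _, _, I, J, N, hdet, hM, hJ⟩ := h
  have h1 : M i j = (A.submatrix (Sum.elim I fun _ : Unit => i)
      (Sum.elim J fun _ : Unit => j)).det / (A.submatrix I J).det := by
    rw [det_submatrix_sumElim hM hJ, mul_div_cancel_left₀ _ hdet]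
  rw [h1]
  exact (heightLe_det_submatrix A _ _).div (heightLe_det_submatrix A _ _)

end Minors

end BooleanFactorization

namespace RationalMachine

open BooleanFactorization

/-! ### The program for the rank factorization -/

/-- Record the pivot column and the scaled pivot row given by the counters `6` and `7` as column
number `nat 2` of the output arrays, subtract their product from array `0`, and count. -/
def pivotStep : Program :=
  Program.seq (fillColumn 1 0 (var 2) (RatExpr.get 0 (var 4) (var 7)))
    (Program.seq (fillColumn 2 1 (var 2)
        (RatExpr.div (RatExpr.get 0 (var 6) (var 4)) (RatExpr.get 0 (var 6) (var 7))))
      (Program.seq (fillMatrix 0 0 1 (RatExpr.sub (RatExpr.get 0 (var 4) (var 5))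
          (RatExpr.mul (RatExpr.get 1 (var 4) (var 2)) (RatExpr.get 2 (var 5) (var 2)))))
        (Program.setNat 2 (NatExpr.const 0) (NatExpr.add (var 2) (NatExpr.const 1)))))

/-- Compute a rank factorization of the matrix in array `0`. -/
def factorize : Program :=
  forLoop 6 0 (forLoop 7 1
    (Program.ite (Test.ratNeZero (RatExpr.get 0 (var 6) (var 7))) pivotStep Program.skip))

/-- The state during the factorization of `A`: array `0` holds `M`, and `A - M` is the product of
the factors written so far. -/
structure PartialFactorization {m n : ℕ} (A M : Matrix (Fin m) (Fin n) ℚ) (s : State) : Prop where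
  row : s.nat 0 0 = m
  col : s.nat 1 0 = n
  matrix : s.matrix 0 m n = M
  schur : IsSchurComplement A M
  rank : M.rank + s.nat 2 0 ≤ A.rank
  sum : ∀ (i : Fin m) (j : Fin n),
    A i j = M i j + ∑ l ∈ Finset.range (s.nat 2 0), s.rat 1 i l * s.rat 2 j l

theorem PartialFactorization.setNat {m n : ℕ} {A M : Matrix (Fin m) (Fin n) ℚ} {s : State}
    (h : PartialFactorization A M s) {c : ℕ} (hc : 2 < c) (v : ℕ) :
    PartialFactorization A M (s.setNat c 0 v) where
  row := by rw [setNat_nat_of_ne _ _ _ (by omega), h.row]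
  col := by rw [setNat_nat_of_ne _ _ _ (by omega), h.col]
  matrix := h.matrix
  schur := h.schur
  rank := by rw [setNat_nat_of_ne _ _ _ (by omega)]; exact h.rank
  sum := by rw [setNat_nat_of_ne _ _ _ (by omega)]; exact h.sum

/-- The pivot column and the scaled pivot row are saved in the output arrays first. The update of
array `0` can then be done in place, since it reads only the saved data and the cell being
overwritten. The largest height is `8 * inputSize A + 1`, whence `16 * inputSize A + 5`. -/
theorem halts_pivotStep {L K m n : ℕ} (hF : FormatLe L K m n) {A M : Matrix (Fin m) (Fin n) ℚ}
    {s : State} (h : PartialFactorization A M s) (hL : 16 * inputSize A + 5 ≤ L) (i : Fin m)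
    (j : Fin n) (hi : s.nat 6 0 = i) (hj : s.nat 7 0 = j) (hij : M i j ≠ 0) :
    Halts L pivotStep s (K * (K * 36 + 82) + 48)
      (fun s' => s'.nat 6 0 = i ∧ s'.nat 7 0 = j ∧
        PartialFactorization A (eliminate M i j) s') := by
  have hB := h.schur.heightLe
  set X := inputSize A with hX
  set k := s.nat 2 0 with hk
  -- A nonzero pivot means that `M` still has positive rank, so fewer than `A.rank ≤ m` pivots were
  -- used; this bounds the size of the pivot counter.
  have hkm : k + 1 ≤ m := by
    have h1 := h.rank
    have h2 := rank_eliminate_lt hij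
    have h3 := A.rank_le_height
    omega
  have hkL : Nat.size k ≤ L := size_mono_le (by omega) hF.rowSize
  have hMe : ∀ (a : Fin m) (b : Fin n), s.rat 0 a b = M a b := fun a b => by
    rw [← h.matrix]; rfl
  have hL1 : 2 * (X + X) + 3 ≤ L := by omega
  refine (Halts.seq (T := K * 24 + 14)
    (T' := (K * 30 + 14) + ((K * (K * 36 + 28) + 14) + 6))
    ((halts_fillColumn (K := K) (v := k) (B := X + X) (fun a => M a j) hF.rowSize (by omega)
      hF.row h.row (by simp) (fun s' hf => yields_var (by rw [hf.1 2 (by simp)]) hkL) ?_).mono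
      (by simp [RatExpr.cost, NatExpr.cost, var]) fun _ h => h) ?_).mono
    (le_of_eq (by ring)) fun _ h => h
  · intro a s' hf h4 _
    exact RatExpr.Yields.get (yields_var h4 (size_mono_le a.2.le hF.rowSize))
      (yields_var (by rw [hf.1 7 (by simp), hj]) (size_mono_le j.2.le hF.colSize))
      (by rw [hf.2 0 (by simp), hMe]) (hB a j) hL1
  rintro s₁ ⟨hf₁, hC, hC'⟩
  refine Halts.seq ((halts_fillColumn (K := K) (v := k) (B := X + X + (X + X))
    (fun b => M i b / M i j) hF.colSize (by omega) hF.col (by rw [hf₁.1 1 (by simp), h.col])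
    (by simp) (fun s' hf => yields_var (by rw [hf.1 2 (by simp), hf₁.1 2 (by simp)]) hkL) ?_).mono
    (by simp [RatExpr.cost, NatExpr.cost, var]) fun _ h => h) ?_
  · intro b s' hf h4 _
    have y6 : (var 6).Yields L s' i := yields_var
      (by rw [hf.1 6 (by simp), hf₁.1 6 (by simp), hi]) (size_mono_le i.2.le hF.rowSize)
    have hr : s'.rat 0 = s.rat 0 := by rw [hf.2 0 (by simp), hf₁.2 0 (by simp)]
    exact (RatExpr.Yields.get y6 (yields_var h4 (size_mono_le b.2.le hF.colSize))
      (by rw [hr, hMe]) (hB i b) hL1).div (RatExpr.Yields.get y6 (yields_var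
        (by rw [hf.1 7 (by simp), hf₁.1 7 (by simp), hj]) (size_mono_le j.2.le hF.colSize))
        (by rw [hr, hMe]) (hB i j) hL1) hij (by omega)
  rintro s₂ ⟨hf₂, hD, hD'⟩
  have hnat₂ : ∀ c, c ≠ 4 → s₂.nat c = s.nat c := fun c hc => by
    rw [hf₂.1 c (by simpa using hc), hf₁.1 c (by simpa using hc)]
  have hC₂ : s₂.rat 1 = s₁.rat 1 := hf₂.2 1 (by simp)
  have h0₂ : s₂.rat 0 = s.rat 0 := by rw [hf₂.2 0 (by simp), hf₁.2 0 (by simp)]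
  refine Halts.seq (T' := 6) ((halts_fillMatrix (K := K)
    (B := X + X + (X + X + (X + X + (X + X))) + 1) (eliminate M i j)
    hF.rowSize hF.colSize (by omega) hF.row hF.col (by rw [hnat₂ 0 (by simp), h.row])
    (by rw [hnat₂ 1 (by simp), h.col]) (by omega) (by omega) ?_).mono
    (by simp [RatExpr.cost, NatExpr.cost, var]) fun _ h => h) ?_
  · intro a b s' hf h4 h5 hcell
    have y4 := yields_var h4 (size_mono_le a.2.le hF.rowSize)
    have y5 := yields_var h5 (size_mono_le b.2.le hF.colSize)
    have y2 : (var 2).Yields L s' k := yields_var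
      (by rw [hf.1 2 (by simp), hnat₂ 2 (by simp)]) hkL
    have y := (RatExpr.Yields.get y4 y5 (by rw [hcell, h0₂, hMe]) (hB a b) hL1).sub
      ((RatExpr.Yields.get (a := 1) y4 y2 (by rw [hf.2 1 (by simp), hC₂, hC]) (hB a j) hL1).mul
        (RatExpr.Yields.get (a := 2) y5 y2 (by rw [hf.2 2 (by simp), hD])
          ((hB i b).div (hB i j)) (by omega)) (by omega)) (by omega)
    -- The program divides the pivot row before multiplying, while `eliminate` multiplies first.
    rwa [← mul_div_assoc] at y
  rintro s₃ ⟨hf₃, hM₃⟩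
  have h2₃ : s₃.nat 2 0 = k := by rw [hf₃.1 2 (by simp), hnat₂ 2 (by simp)]
  have y : (NatExpr.add (var 2) (NatExpr.const 1)).Yields L s₃ (k + 1) := by
    have y2 := yields_var h2₃ hkL
    refine ⟨⟨y2.1, ?_, ?_⟩, ?_⟩
    · simp [NatExpr.Fits]; omega
    · simp only [NatExpr.eval, y2.2]
      exact size_mono_le hkm hF.rowSize
    · simp only [NatExpr.eval, y2.2]
  have hnat₃ : ∀ c, c ≠ 2 → c ≠ 4 → c ≠ 5 → (s₃.setNat 2 0 (k + 1)).nat c = s.nat c :=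
    fun c h2 h4 h5 => by
      rw [setNat_nat_of_ne _ _ _ h2, hf₃.1 c (by simp; omega), hnat₂ c h4]
  have hrank := rank_eliminate_lt hij
  refine (Halts.setNat (Q := fun s' => s' = s₃.setNat 2 0 (k + 1)) (yields_zero L s₃) y rfl).mono
    le_rfl ?_
  rintro _ rfl
  refine ⟨by rw [hnat₃ 6 (by simp) (by simp) (by simp), hi],
    by rw [hnat₃ 7 (by simp) (by simp) (by simp), hj],
    by rw [hnat₃ 0 (by simp) (by simp) (by simp), h.row],
    by rw [hnat₃ 1 (by simp) (by simp) (by simp), h.col], hM₃, h.schur.eliminate hij, ?_, ?_⟩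
  · rw [setNat_nat_self]
    have := h.rank
    omega
  · intro a b
    have e1 : ∀ l, s₃.rat 1 a l = s₁.rat 1 a l := fun l => by rw [hf₃.2 1 (by simp), hC₂]
    have e2 : ∀ l, s₃.rat 2 b l = s₂.rat 2 b l := fun l => by rw [hf₃.2 2 (by simp)]
    have hold : ∑ l ∈ Finset.range k, s₁.rat 1 a l * s₂.rat 2 b l =
        ∑ l ∈ Finset.range k, s.rat 1 a l * s.rat 2 b l := by
      refine Finset.sum_congr rfl fun l hl => ?_
      have hlk : l ≠ k := (Finset.mem_range.1 hl).ne
      rw [hC' _ _ hlk, hD' _ _ hlk, hf₁.2 2 (by simp)]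
    rw [setNat_nat_self, setNat_rat, Finset.sum_range_succ]
    simp only [e1, e2]
    rw [hold, hC, hD, h.sum a b, eliminate, Matrix.of_apply]
    ring

/-- One sweep in row-major order suffices: elimination clears the whole pivot row, and rows that are
already zero stay zero. After the sweep the remainder is zero. -/
theorem halts_factorize {L K m n : ℕ} (hF : FormatLe L K m n) (A : Matrix (Fin m) (Fin n) ℚ)
    (hL : 16 * inputSize A + 5 ≤ L) :
    Halts L factorize (inputState A)
      (K * ((K * ((17 + (K * (K * 36 + 82) + 48)) + 14) + 14) + 14) + 14)
      (PartialFactorization A 0) := by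
  have h3 := hF.three_le
  let Good (D : ℕ → ℕ → Prop) (s : State) : Prop :=
    ∃ M, PartialFactorization A M s ∧ ∀ (a : Fin m) (b : Fin n), D a b → M a b = 0
  refine (halts_forLoop (N := m) (fun k s => Good (fun a _ => a < k) s) hF.rowSize (by omega)
    hF.row ?_ ?_ ?_ ?_).mono le_rfl ?_
  · rintro k s ⟨M, h, -⟩
    exact h.row
  · rintro k s v ⟨M, h, hz⟩
    exact ⟨M, h.setNat (by omega) v, hz⟩
  · refine ⟨A, ⟨rfl, rfl, ?_, IsSchurComplement.self, by simp [inputState], ?_⟩,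
      fun _ _ hf => absurd hf (Nat.not_lt_zero _)⟩
    · ext i j
      simp [State.matrix, inputState]
    · intro i j
      simp [inputState]
  · rintro k hk s₁ hk₁ ⟨M₁, hp₁, hz₁⟩
    refine (halts_forLoop (N := n) (fun l s => s.nat 6 0 = k ∧
      Good (fun a b => a < k ∨ (a = k ∧ b < l)) s) hF.colSize (by omega) hF.col
      ?_ ?_ ?_ ?_).mono le_rfl ?_
    · rintro l s ⟨-, M, h, -⟩
      exact h.col
    · rintro l s v ⟨h6, M, h, hz⟩
      exact ⟨by rw [setNat_nat_of_ne _ _ _ (by omega), h6], M, h.setNat (by omega) v, hz⟩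
    · exact ⟨hk₁, M₁, hp₁, fun a b hab => hz₁ a b (by omega)⟩
    · rintro l hl s₂ hl₂ ⟨hk₂, M, hp, hz⟩
      have y := RatExpr.Yields.get (L := L) (a := 0)
        (yields_var hk₂ (size_mono_le hk.le hF.rowSize))
        (yields_var hl₂ (size_mono_le hl.le hF.colSize)) (q := M ⟨k, hk⟩ ⟨l, hl⟩)
        (by rw [← hp.matrix]; rfl) (hp.schur.heightLe _ _) (by omega)
      refine (Halts.ite (Test.ratNeZero_spec y h3) (T := K * (K * 36 + 82) + 48)
        (fun h0 => ?_) (fun h0 => ?_)).mono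
        (by simp [Test.cost, Test.ratNeZero, RatExpr.cost, NatExpr.cost, var]) fun _ h => h
      · refine (halts_pivotStep hF hp hL ⟨k, hk⟩ ⟨l, hl⟩ hk₂ hl₂ h0).mono le_rfl ?_
        rintro s' ⟨h6, h7, hp'⟩
        refine ⟨h7, h6, _, hp', fun a b hab => ?_⟩
        rcases hab with ha | ⟨ha, -⟩
        · simp [eliminate, hz a _ (Or.inl ha)]
        · obtain rfl : a = ⟨k, hk⟩ := Fin.ext ha
          simp [eliminate, mul_div_cancel_left₀ _ h0]
      · refine (Halts.skip ⟨hl₂, hk₂, M, hp, fun a b hab => ?_⟩).mono (by omega) fun _ h => h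
        by_cases hnew : (a : ℕ) = k ∧ (b : ℕ) = l
        · obtain rfl : a = ⟨k, hk⟩ := Fin.ext hnew.1
          obtain rfl : b = ⟨l, hl⟩ := Fin.ext hnew.2
          exact not_not.1 h0
        · exact hz a b (by omega)
    · rintro s' ⟨h6, M, hp, hz⟩
      exact ⟨h6, M, hp, fun a b hab => hz a b (by have := b.2; omega)⟩
  · rintro s' ⟨M, hp, hz⟩
    obtain rfl : M = 0 := Matrix.ext fun a b => hz a b a.2
    exact hp

/-- The invariant bounds the number of pivots by the rank, and the factorization itself bounds the
rank by the number of columns, so the two agree. -/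
theorem PartialFactorization.outputsRankFactorization {m n : ℕ} {A : Matrix (Fin m) (Fin n) ℚ}
    {s : State} (h : PartialFactorization A 0 s) : OutputsRankFactorization m n A s := by
  have hfac : A = s.matrix 1 m (s.nat 2 0) * (s.matrix 2 n (s.nat 2 0)).transpose := by
    ext i j
    rw [h.sum i j, Finset.sum_range, Matrix.mul_apply, Matrix.zero_apply, zero_add]
    rfl
  have hle : A.rank ≤ s.nat 2 0 := by
    conv_lhs => rw [hfac]
    exact (Matrix.rank_mul_le_left _ _).trans (Matrix.rank_le_width _)
  have heq : s.nat 2 0 = A.rank := le_antisymm (by have := h.rank; omega) hle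
  exact ⟨heq, by unfold IsRankFactorization; rw [← heq]; exact hfac⟩

theorem solvable_rankFactorization :
    SolvableInStronglyPolynomialTime (fun _ _ _ => True) OutputsRankFactorization := by
  refine solvable_of_isPolynomial factorize
    (T := fun K => K * ((K * ((17 + (K * (K * 36 + 82) + 48)) + 14) + 14) + 14) + 14)
    (S := fun X => 16 * X + 5) ?_ (((IsPolynomial.const _).mul .id).add (.const _)) ?_
  · have h : IsPolynomial fun K => K * (K * 36 + 82) + 48 :=
      (IsPolynomial.id.mul ((IsPolynomial.id.mul (.const _)).add (.const _))).add (.const _)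
    exact (IsPolynomial.id.mul (((IsPolynomial.id.mul (((IsPolynomial.const 17).add h).add
      (.const 14))).add (.const 14)).add (.const 14))).add (.const 14)
  · intro m n A hm hn _
    exact (halts_factorize (formatLe_mul A hm hn (by omega) (by omega)) A le_rfl).mono le_rfl
      fun _ h => h.outputsRankFactorization

end RationalMachine

theorem mainTheorem5 (r : ℕ) :
    RationalMachine.SolvableInStronglyPolynomialTime (fun _ _ A => A.rank ≤ r)
        (BooleanFactorization.OutputsBestApproximation {k | k = 1}) ∧
      RationalMachine.SolvableInStronglyPolynomialTime (fun _ _ A => A.rank ≤ r)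
        (BooleanFactorization.OutputsBestApproximation {k | k ≤ 1}) ∧
      RationalMachine.SolvableInStronglyPolynomialTime (fun _ _ _ => True)
        BooleanFactorization.OutputsRankFactorization :=
  ⟨RationalMachine.solvable_rank_eq_one r, RationalMachine.solvable_rank_le_one r,
    RationalMachine.solvable_rankFactorization⟩
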